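/- Let $d\ge 1$. A $d$-dimensional Fano polyhedron is a convex polytope $P\subset\mathbb R^d$ with vertices in $\mathbb Z^d$ that contains $0$ in its interior and is simplicial (every proper face is a simplex), and such that the vertices of each facet form a $\mathbb Z$-basis of $\mathbb Z^d$. Two such polyhedra are isomorphic if an element of $\mathrm{GL}(d,\mathbb Z)$ maps one onto the other, and combinatorially equivalent if there is a bijection of their vertex sets under which vertex sets of faces that are simplices correspond to each other in both directions. Let $\Sigma(P)$ be the fan consisting of $\{0\}$ and the cones spanned by the vertices of the proper faces of $P$. A set $\mathcal P$ of vertices is a primitive collection if it is contained in no cone of $\Sigma(P)$, but each of its proper subsets is. Its primitive relation is $\sum_{v\in\mathcal P}v=c_1w_1+\dots+c_mw_m$, where $w_1,\dots,w_m$ are the vertices generating the cone of minimal dimension in $\Sigma(P)$ that contains $\sum_{v\in\mathcal P}v$ and the $c_i$ are positive integers (the right side is $0$ if $m=0$). **Theorem.** Up to isomorphism there are exactly $28$ four-dimensional Fano polyhedra with $7$ vertices. They form exactly three combinatorial equivalence classes, the types $D$, $E$, $G$, containing $19$, $3$ and $6$ isomorphism classes respectively. In a suitable numbering $v_1,\dots,v_7$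 of the vertices, the primitive collections are precisely the sets occurring on the left sides below. Each of the following $28$ systems is the complete system of primitive relations of such a polyhedron in a suitable numbering of its vertices; every four-dimensional Fano polyhedron with $7$ vertices is described in this way by exactly one of the systems; and two of these polyhedra are isomorphic if and only if they are described by the same system. (i) Type $D$: the values of $(v_1+v_2+v_3,\ v_4+v_5,\ v_6+v_7)$ are $D_1:(2v_6,v_6,0)$, $D_2:(2v_4,v_6,0)$, $D_3:(v_4+v_6,v_6,0)$, $D_4:(2v_6,v_1,0)$, $D_5:(2v_4,0,0)$, $D_6:(v_6,v_6,0)$, $D_7:(0,v_1,v_1)$, $D_8:(v_4,v_6,0)$, $D_9:(v_4+v_6,0,0)$, $D_{10}:(v_6,v_1,0)$, $D_{11}:(0,v_1,v_4)$, $D_{12}:(v_4,0,0)$, $D_{13}:(0,0,0)$, $D_{14}:(0,0,v_1)$, $D_{15}:(0,0,v_4)$, $D_{16}:(v_4+v_7,v_6,0)$, $D_{17}:(0,v_1,v_2)$, $D_{18}:(2v_7,v_6,0)$, $D_{19}:(v_7,v_6,0)$. (ii) Type $E$: $v_1+v_7=0$, $v_1+v_2=v_6$, $v_6+v_7=v_2$,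 and the values of $(v_2+v_3+v_4+v_5,\ v_3+v_4+v_5+v_6)$ are $E_1:(2v_1,3v_1)$, $E_2:(v_1,2v_1)$, $E_3:(0,v_1)$. (iii) Type $G$: the values of $(v_1+v_7,\ v_2+v_3+v_4,\ v_4+v_5+v_6,\ v_5+v_6+v_7,\ v_1+v_2+v_3)$ are $G_1:(0,v_1,2v_1,v_2+v_3,v_5+v_6)$, $G_2:(v_4,v_7,2v_1,v_1,0)$, $G_3:(0,0,v_1,v_2+v_3,v_5+v_6)$, $G_4:(v_4,v_7,v_1+v_2,v_2,0)$, $G_5:(v_4,v_7,0,v_2+v_3,0)$, $G_6:(v_4,v_7,v_1,0,0)$. -/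

import Mathlib

noncomputable section

namespace FanoClassification

/-- The set of vertices of a convex set (for a polytope: its extreme points). -/
def vertices {d : ℕ} (P : Set (Fin d → ℝ)) : Set (Fin d → ℝ) :=
  P.extremePoints ℝ

/-- The standard lattice `ℤ ^ d` inside `ℝ ^ d`. -/
def stdLattice (d : ℕ) : Submodule ℤ (Fin d → ℝ) :=
  Submodule.span ℤ (Set.range (Pi.basisFun ℝ (Fin d)))

/-- Proper faces of a convex polytope: the sets where a linear functional is maximal on `P`,
other than `P` itself. The empty set counts as a (proper) face. -/
def IsProperFace {d : ℕ} (P F : Set (Fin d → ℝ)) : Prop :=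
  IsExposed ℝ P F ∧ F ≠ P

/-- `F` is a nonempty face of `P` of dimension `k`. -/
def IsFaceOfDim {d : ℕ} (P F : Set (Fin d → ℝ)) (k : ℕ) : Prop :=
  IsExposed ℝ P F ∧ F.Nonempty ∧ Module.finrank ℝ (vectorSpan ℝ F) = k

/-- The elements of `W` form a `ℤ`-basis of the lattice `ℤ ^ d`. -/
def IsLatticeBasis {d : ℕ} (W : Set (Fin d → ℝ)) : Prop :=
  LinearIndependent ℤ (Subtype.val : W → (Fin d → ℝ)) ∧ Submodule.span ℤ W = stdLattice d

/-- `d`-dimensional Fano polyhedra in `ℝ ^ d`. -/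
structure IsFanoPolyhedron {d : ℕ} (P : Set (Fin d → ℝ)) : Prop where
  /-- `P` is a convex polytope. -/
  polytope : ∃ s : Set (Fin d → ℝ), s.Finite ∧ P = convexHull ℝ s
  /-- The vertices are lattice points. -/
  integral : ∀ v ∈ vertices P, v ∈ stdLattice d
  /-- The origin lies in the interior. -/
  zero_mem : (0 : Fin d → ℝ) ∈ interior P
  /-- Every proper face is a simplex. -/
  simplicial : ∀ F, IsProperFace P F →
    AffineIndependent ℝ (Subtype.val : vertices F → (Fin d → ℝ))
  /-- The vertices of every facet form a basis of the lattice. -/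
  unimodular : ∀ F k, k + 1 = d → IsFaceOfDim P F k → IsLatticeBasis (vertices F)

/-- The cone `σ(F)` of all nonnegative combinations of the vertices of `F`. -/
def faceCone {d : ℕ} (F : Set (Fin d → ℝ)) : PointedCone ℝ (Fin d → ℝ) :=
  PointedCone.hull ℝ (vertices F)

/-- The fan `Σ(P)`: all cones `σ(F)` over the proper faces (the empty face contributes `{0}`). -/
def fan {d : ℕ} (P : Set (Fin d → ℝ)) : Set (PointedCone ℝ (Fin d → ℝ)) :=
  {σ | ∃ F, IsProperFace P F ∧ σ = faceCone F}

/-- The dimension of a cone, i.e. of its linear span. -/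
def coneDim {d : ℕ} (σ : PointedCone ℝ (Fin d → ℝ)) : ℕ :=
  Module.finrank ℝ (Submodule.span ℝ (σ : Set (Fin d → ℝ)))

/-- Primitive collections: sets of vertices that lie in no cone of the fan, although each of
their proper subsets does. -/
def IsPrimitiveCollection {d : ℕ} (P : Set (Fin d → ℝ)) (C : Finset (Fin d → ℝ)) : Prop :=
  (C : Set (Fin d → ℝ)) ⊆ vertices P ∧
  (¬ ∃ σ ∈ fan P, (C : Set (Fin d → ℝ)) ⊆ σ) ∧
  ∀ B : Finset (Fin d → ℝ), B ⊂ C → ∃ σ ∈ fan P, (B : Set (Fin d → ℝ)) ⊆ σ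

/-- `C` is a primitive collection of `P` and its primitive relation is
`∑ x ∈ C, x = c₁ w₁ + ⋯ + cₘ wₘ`, where the right side is recorded by the multiset `R` in which
`w₁, …, wₘ` occur with the multiplicities `c₁, …, cₘ`. So `w₁, …, wₘ` are the generators
of the cone of minimal dimension in the fan that contains the sum of `C`. -/
def IsPrimitiveRelation {d : ℕ} (P : Set (Fin d → ℝ)) (C : Finset (Fin d → ℝ))
    (R : Multiset (Fin d → ℝ)) : Prop :=
  IsPrimitiveCollection P C ∧
  ∃ F, IsProperFace P F ∧ ∑ x ∈ C, x ∈ faceCone F ∧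
    (∀ τ ∈ fan P, ∑ x ∈ C, x ∈ τ → coneDim (faceCone F) ≤ coneDim τ) ∧
    {x | x ∈ R} = vertices F ∧
    ∑ x ∈ C, x = R.sum

/-- The `d`-dimensional Fano polyhedra with exactly `n` vertices. -/
def FanoPolyhedron (d n : ℕ) : Type :=
  {P : Set (Fin d → ℝ) // IsFanoPolyhedron P ∧ (vertices P).ncard = n}

/-- The linear action of an integral matrix on `ℝ ^ d`. -/
def act {d : ℕ} (A : Matrix (Fin d) (Fin d) ℤ) (x : Fin d → ℝ) : Fin d → ℝ :=
  (A.map (Int.cast : ℤ → ℝ)).mulVec x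

/-- Isomorphism of Fano polyhedra: some element of `GL(d, ℤ)` maps one onto the other. -/
def Isomorphic {d n : ℕ} (P Q : FanoPolyhedron d n) : Prop :=
  ∃ A : GL (Fin d) ℤ, act A.val '' P.1 = Q.1

theorem act_one {d : ℕ} (x : Fin d → ℝ) : act (1 : Matrix (Fin d) (Fin d) ℤ) x = x := by
  simp [act, Matrix.map_one]

theorem act_mul {d : ℕ} (A B : Matrix (Fin d) (Fin d) ℤ) (x : Fin d → ℝ) :
    act (A * B) x = act A (act B x) := by
  have h : (A * B).map (Int.cast : ℤ → ℝ) = A.map Int.cast * B.map Int.cast :=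
    Matrix.map_mul (f := Int.castRingHom ℝ)
  simp [act, h, Matrix.mulVec_mulVec]

theorem isomorphic_equivalence (d n : ℕ) :
    Equivalence (Isomorphic : FanoPolyhedron d n → FanoPolyhedron d n → Prop) where
  refl P := ⟨1, by simp [act_one]⟩
  symm := by
    rintro P Q ⟨A, hA⟩
    refine ⟨A⁻¹, ?_⟩
    rw [← hA, Set.image_image]
    simp [← act_mul, act_one]
  trans := by
    rintro P Q R ⟨A, hA⟩ ⟨B, hB⟩
    refine ⟨B * A, ?_⟩
    rw [← hB, ← hA, Set.image_image]
    simp [act_mul]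

/-- Isomorphism as an equivalence relation. -/
def isoSetoid (d n : ℕ) : Setoid (FanoPolyhedron d n) :=
  ⟨Isomorphic, isomorphic_equivalence d n⟩

/-- Isomorphism classes of `d`-dimensional Fano polyhedra with `n` vertices. -/
def IsoClass (d n : ℕ) : Type := Quotient (isoSetoid d n)

/-- The isomorphism class of a Fano polyhedron. -/
def FanoPolyhedron.isoClass {d n : ℕ} (P : FanoPolyhedron d n) : IsoClass d n :=
  Quotient.mk (isoSetoid d n) P

/-- `S` is the vertex set of a face of dimension `|S| - 1`. -/
def IsSimplexFace {d : ℕ} (P S : Set (Fin d → ℝ)) : Prop :=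
  ∃ F k, IsFaceOfDim P F k ∧ vertices F = S ∧ k + 1 = S.ncard

/-- Combinatorial equivalence: a bijection of the vertices that respects faces. -/
def CombinatoriallyEquivalent {d n : ℕ} (P Q : FanoPolyhedron d n) : Prop :=
  ∃ ρ : vertices P.1 ≃ vertices Q.1, ∀ S : Set (vertices P.1),
    IsSimplexFace P.1 (Subtype.val '' S) ↔ IsSimplexFace Q.1 (Subtype.val '' (ρ '' S))

/-- The three combinatorial types. -/
inductive CombType
  | D | E | G

/-! The vertices are numbered `1, …, 7`. We use `Fin 7` for the indices, where the
numeral `7` denotes the same element as `0`, so that `1, …, 7` are its seven elements. -/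

/-- The primitive collections of each combinatorial type. -/
def CombType.collections : CombType → List (Finset (Fin 7))
  | .D => [{1, 2, 3}, {4, 5}, {6, 7}]
  | .E => [{1, 7}, {1, 2}, {6, 7}, {2, 3, 4, 5}, {3, 4, 5, 6}]
  | .G => [{1, 7}, {2, 3, 4}, {4, 5, 6}, {5, 6, 7}, {1, 2, 3}]

/-- A numbering of the vertices of `P`. -/
def IsNumbering {d n : ℕ} (P : FanoPolyhedron d n) (v : Fin n ↪ (Fin d → ℝ)) : Prop :=
  Set.range v = vertices P.1

/-- `P` has combinatorial type `t`: for some numbering of the vertices, the primitive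
collections are exactly those of `t`. -/
def HasType (P : FanoPolyhedron 4 7) (t : CombType) : Prop :=
  ∃ v : Fin 7 ↪ (Fin 4 → ℝ), IsNumbering P v ∧
    ∀ S : Finset (Fin 7), IsPrimitiveCollection P.1 (S.map v) ↔ S ∈ t.collections

/-- The names `D₁, …, D₁₉`, `E₁, E₂, E₃`, `G₁, …, G₆`; here `D i` stands for `D_{i+1}` with
`i = 0, …, 18`, and so on. -/
inductive Name
  | D (i : Fin 19)
  | E (i : Fin 3)
  | G (i : Fin 6)

/-- The combinatorial type of a name. -/
def Name.type : Name → CombType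
  | .D _ => .D
  | .E _ => .E
  | .G _ => .G

/-- Right sides of the relations `v₁ + v₂ + v₃ = …`, `v₄ + v₅ = …`, `v₆ + v₇ = …`;
for example `{4, 6}` stands for `v₄ + v₆`, `{6, 6}` for `2 v₆`, and `0` for `0`. -/
def rightD : Fin 19 → Multiset (Fin 7) × Multiset (Fin 7) × Multiset (Fin 7) :=
  ![({6, 6}, {6}, 0),
    ({4, 4}, {6}, 0),
    ({4, 6}, {6}, 0),
    ({6, 6}, {1}, 0),
    ({4, 4}, 0, 0),
    ({6}, {6}, 0),
    (0, {1}, {1}),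
    ({4}, {6}, 0),
    ({4, 6}, 0, 0),
    ({6}, {1}, 0),
    (0, {1}, {4}),
    ({4}, 0, 0),
    (0, 0, 0),
    (0, 0, {1}),
    (0, 0, {4}),
    ({4, 7}, {6}, 0),
    (0, {1}, {2}),
    ({7, 7}, {6}, 0),
    ({7}, {6}, 0)]

/-- Right sides of the relations `v₂ + v₃ + v₄ + v₅ = …` and `v₃ + v₄ + v₅ + v₆ = …`. -/
def rightE : Fin 3 → Multiset (Fin 7) × Multiset (Fin 7) :=
  ![({1, 1}, {1, 1, 1}),
    ({1}, {1, 1}),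
    (0, {1})]

/-- Right sides of the relations `v₁ + v₇ = …`, `v₂ + v₃ + v₄ = …`, `v₄ + v₅ + v₆ = …`,
`v₅ + v₆ + v₇ = …`, `v₁ + v₂ + v₃ = …`. -/
def rightG : Fin 6 → Multiset (Fin 7) × Multiset (Fin 7) × Multiset (Fin 7) ×
    Multiset (Fin 7) × Multiset (Fin 7) :=
  ![(0, {1}, {1, 1}, {2, 3}, {5, 6}),
    ({4}, {7}, {1, 1}, {1}, 0),
    (0, 0, {1}, {2, 3}, {5, 6}),
    ({4}, {7}, {1, 2}, {2}, 0),
    ({4}, {7}, 0, {2, 3}, 0),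
    ({4}, {7}, {1}, 0, 0)]

/-- The list of primitive relations belonging to each name: pairs of a primitive collection
and the right side of its relation. -/
def Name.relations : Name → List (Finset (Fin 7) × Multiset (Fin 7))
  | .D i =>
    [({1, 2, 3}, (rightD i).1), ({4, 5}, (rightD i).2.1), ({6, 7}, (rightD i).2.2)]
  | .E i =>
    [({1, 7}, 0), ({1, 2}, {6}), ({6, 7}, {2}),
     ({2, 3, 4, 5}, (rightE i).1), ({3, 4, 5, 6}, (rightE i).2)]
  | .G i =>
    [({1, 7}, (rightG i).1), ({2, 3, 4}, (rightG i).2.1), ({4, 5, 6}, (rightG i).2.2.1),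
     ({5, 6, 7}, (rightG i).2.2.2.1), ({1, 2, 3}, (rightG i).2.2.2.2)]

/-- `P` is described by the primitive relations belonging to `a`: for some numbering of the
vertices, these are exactly the primitive relations of `P`. -/
def DescribedBy (P : FanoPolyhedron 4 7) (a : Name) : Prop :=
  ∃ v : Fin 7 ↪ (Fin 4 → ℝ), IsNumbering P v ∧
    (∀ S : Finset (Fin 7),
      IsPrimitiveCollection P.1 (S.map v) ↔ ∃ r ∈ a.relations, r.1 = S) ∧
    ∀ r ∈ a.relations, IsPrimitiveRelation P.1 (r.1.map v) (r.2.map v)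

/-- The isomorphism classes of Fano polyhedra of a given combinatorial type. -/
def classesOfType (t : CombType) : Set (IsoClass 4 7) :=
  {q | ∃ P : FanoPolyhedron 4 7, P.isoClass = q ∧ HasType P t}

end FanoClassification

end

/-! A four-dimensional Fano polyhedron with 7 vertices is determined by one facet together with the
coordinates of the three remaining vertices in the lattice basis given by that facet: a 3 × 4
integer matrix. Choose the facet whose functional is largest at the sum of all vertices. Passing to
an adjacent facet subtracts a positive multiple of one coordinate from the functional, so maximality
forces the sum of all vertices to have nonnegative coordinates (`exists_special_facet`). Hence every
column of the matrix sums to at least -1. The heights (row sums) are nonpositive integers, so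
together they are at least -4. Adjacency (`exists_neighbor`) puts an entry -1 into each column and
bounds the other entries from below. Only finitely many matrices remain, and the adjacency condition
can be imposed again after each exchange of a base vertex.

With rows ordered by height and columns by a key, `mem_candidates` places the matrix in an explicit
list, and `allMatch_candidates` checks by evaluation that every member is a renumbering of one of
the 28 listed systems of vectors.

Conversely, the listed vectors span a Fano polyhedron whose proper faces correspond to the free
index sets, those containing no listed primitive collection. Every free set lies in a listed facet,
and tilting the functional of that facet exposes exactly the given set (`Name.exists_functional`).
No other proper faces exist, because each listed relation has fewer terms on the right than on the
left (`Name.exists_free_of_isProperFace`). The fan, the primitive collections and the primitive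
relations follow from this, in the coordinates of any basis.

For uniqueness, a sum of vertices of one proper face determines its summands (`Name.eq_of_sum_eq`).
So the primitive relations are determined up to renumbering, and the renumbering invariant
`Name.code` separates the 28 names. Two polyhedra with the same name differ by a change of lattice
basis, that is, by an element of `GL(4, ℤ)`. -/

namespace FanoClassification

/-! ### Standard coordinates of the listed polyhedra -/

/-- A facet of each combinatorial type, used as coordinate frame. -/
def CombType.base : CombType → Fin 4 → Fin 7
  | .D => ![1, 2, 4, 6]
  | .E => ![1, 6, 3, 4]
  | .G => ![2, 3, 5, 6]

/-- Coordinates of `v₃, v₅, v₇` with respect to `v₁, v₂, v₄, v₆`. -/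
def coordsD : Fin 19 → Fin 3 → Fin 4 → ℤ :=
  ![![![-1, -1, 0, 2], ![0, 0, -1, 1], ![0, 0, 0, -1]],
    ![![-1, -1, 2, 0], ![0, 0, -1, 1], ![0, 0, 0, -1]],
    ![![-1, -1, 1, 1], ![0, 0, -1, 1], ![0, 0, 0, -1]],
    ![![-1, -1, 0, 2], ![1, 0, -1, 0], ![0, 0, 0, -1]],
    ![![-1, -1, 2, 0], ![0, 0, -1, 0], ![0, 0, 0, -1]],
    ![![-1, -1, 0, 1], ![0, 0, -1, 1], ![0, 0, 0, -1]],
    ![![-1, -1, 0, 0], ![1, 0, -1, 0], ![1, 0, 0, -1]],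
    ![![-1, -1, 1, 0], ![0, 0, -1, 1], ![0, 0, 0, -1]],
    ![![-1, -1, 1, 1], ![0, 0, -1, 0], ![0, 0, 0, -1]],
    ![![-1, -1, 0, 1], ![1, 0, -1, 0], ![0, 0, 0, -1]],
    ![![-1, -1, 0, 0], ![1, 0, -1, 0], ![0, 0, 1, -1]],
    ![![-1, -1, 1, 0], ![0, 0, -1, 0], ![0, 0, 0, -1]],
    ![![-1, -1, 0, 0], ![0, 0, -1, 0], ![0, 0, 0, -1]],
    ![![-1, -1, 0, 0], ![0, 0, -1, 0], ![1, 0, 0, -1]],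
    ![![-1, -1, 0, 0], ![0, 0, -1, 0], ![0, 0, 1, -1]],
    ![![-1, -1, 1, -1], ![0, 0, -1, 1], ![0, 0, 0, -1]],
    ![![-1, -1, 0, 0], ![1, 0, -1, 0], ![0, 1, 0, -1]],
    ![![-1, -1, 0, -2], ![0, 0, -1, 1], ![0, 0, 0, -1]],
    ![![-1, -1, 0, -1], ![0, 0, -1, 1], ![0, 0, 0, -1]]]

/-- Coordinates of `v₂, v₅, v₇` with respect to `v₁, v₆, v₃, v₄`. -/
def coordsE : Fin 3 → Fin 3 → Fin 4 → ℤ :=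
  ![![![-1, 1, 0, 0], ![3, -1, -1, -1], ![-1, 0, 0, 0]],
    ![![-1, 1, 0, 0], ![2, -1, -1, -1], ![-1, 0, 0, 0]],
    ![![-1, 1, 0, 0], ![1, -1, -1, -1], ![-1, 0, 0, 0]]]

/-- Coordinates of `v₁, v₄, v₇` with respect to `v₂, v₃, v₅, v₆`. -/
def coordsG : Fin 6 → Fin 3 → Fin 4 → ℤ :=
  ![![![-1, -1, 1, 1], ![-2, -2, 1, 1], ![1, 1, -1, -1]],
    ![![-1, -1, 0, 0], ![-2, -2, -1, -1], ![-1, -1, -1, -1]],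
    ![![-1, -1, 1, 1], ![-1, -1, 0, 0], ![1, 1, -1, -1]],
    ![![-1, -1, 0, 0], ![0, -1, -1, -1], ![1, 0, -1, -1]],
    ![![-1, -1, 0, 0], ![0, 0, -1, -1], ![1, 1, -1, -1]],
    ![![-1, -1, 0, 0], ![-1, -1, -1, -1], ![0, 0, -1, -1]]]

/-- Vectors realizing the relations of `a`, normalized on the base facet. -/
def Name.stdVec : Name → Fin 7 → Fin 4 → ℤ
  | .D i => ![coordsD i 2, ![1, 0, 0, 0], ![0, 1, 0, 0], coordsD i 0, ![0, 0, 1, 0],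
      coordsD i 1, ![0, 0, 0, 1]]
  | .E i => ![coordsE i 2, ![1, 0, 0, 0], coordsE i 0, ![0, 0, 1, 0], ![0, 0, 0, 1],
      coordsE i 1, ![0, 1, 0, 0]]
  | .G i => ![coordsG i 2, coordsG i 0, ![1, 0, 0, 0], ![0, 1, 0, 0], coordsG i 1,
      ![0, 0, 1, 0], ![0, 0, 0, 1]]

/-! ### Enumeration of coordinate matrices -/

/-- The value of the functional of the base facet on the `k`-th remaining vertex. -/
def height (M : Fin 3 → Fin 4 → ℤ) (k : Fin 3) : ℤ := M k 0 + M k 1 + M k 2 + M k 3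

/-- The `k`-th remaining vertex is the vertex of the facet adjacent to the base facet along the
ridge omitting the `i`-th base vertex. -/
def isNeighbor (M : Fin 3 → Fin 4 → ℤ) (i : Fin 4) (k : Fin 3) : Bool :=
  decide (M k i = -1) &&
    [0, 1, 2].all fun z => decide (z = k) || decide ((1 - height M k) * (-M z i) < 1 - height M z)

/-- Coordinates of the remaining vertices after exchanging the `i`-th base vertex and the `k`-th
remaining vertex. -/
def pivot (M : Fin 3 → Fin 4 → ℤ) (i : Fin 4) (k : Fin 3) : Fin 3 → Fin 4 → ℤ := fun z j =>
  if z = k then (if j = i then -1 else M k j)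
  else (if j = i then -M z i else M z j + M z i * M k j)

/-- Neighbors exist along all facets reached in fewer than `n` steps from the base facet. -/
def hasNeighbors : ℕ → (Fin 3 → Fin 4 → ℤ) → Bool
  | 0, _ => true
  | n + 1, M => [0, 1, 2, 3].all fun i => [0, 1, 2].any fun k =>
      isNeighbor M i k && hasNeighbors n (pivot M i k)

/-- A triple of integers: a column of the coordinate matrix, or the list of heights. -/
abbrev Triple := ℤ × ℤ × ℤ

/-- The total of a triple. -/
def Triple.total (c : Triple) : ℤ := c.1 + c.2.1 + c.2.2

/-- A key by which columns are ordered. -/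
def Triple.key (c : Triple) : ℤ := 10000 * c.1 + 100 * c.2.1 + c.2.2

/-- The key as a natural number, for fast comparison. -/
def Triple.natKey (c : Triple) : ℕ := (c.key + 60000).toNat

/-- The total as a natural number, for fast comparison. -/
def Triple.natTotal (c : Triple) : ℕ := (c.total + 10).toNat

/-- The possible lists of heights in decreasing order. -/
def heightList : List Triple :=
  [(0, 0, 0), (0, 0, -1), (0, 0, -2), (0, 0, -3), (0, 0, -4), (0, -1, -1), (0, -1, -2),
   (0, -1, -3), (0, -2, -2), (-1, -1, -1), (-1, -1, -2)]

/-- The conditions on a column for given heights. -/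
def isColumn (h c : Triple) : Bool :=
  decide (-1 ≤ c.total) && decide (c.total ≤ h.total + 3) &&
  ((decide (c.1 = -1) && decide ((1 - h.1) * (-c.2.1) < 1 - h.2.1) &&
      decide ((1 - h.1) * (-c.2.2) < 1 - h.2.2)) ||
   (decide (c.2.1 = -1) && decide ((1 - h.2.1) * (-c.1) < 1 - h.1) &&
      decide ((1 - h.2.1) * (-c.2.2) < 1 - h.2.2)) ||
   (decide (c.2.2 = -1) && decide ((1 - h.2.2) * (-c.1) < 1 - h.1) &&
      decide ((1 - h.2.2) * (-c.2.1) < 1 - h.2.1)))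

/-- The integers that may occur in a row of height `h`. -/
def entries (h : ℤ) : List ℤ := (List.range (5 - 3 * h).toNat).map fun n : ℕ => h - 1 + (n : ℤ)

/-- The possible columns for given heights. -/
def columns (h : Triple) : List Triple :=
  (entries h.1).flatMap fun x => (entries h.2.1).flatMap fun y => (entries h.2.2).filterMap fun z =>
    if isColumn h (x, y, z) then some (x, y, z) else none

/-- The matrix with given columns. -/
def ofColumns (c₁ c₂ c₃ c₄ : Triple) : Fin 3 → Fin 4 → ℤ :=
  ![![c₁.1, c₂.1, c₃.1, c₄.1], ![c₁.2.1, c₂.2.1, c₃.2.1, c₄.2.1],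
    ![c₁.2.2, c₂.2.2, c₃.2.2, c₄.2.2]]

/-- No row of `M` vanishes, and `M` satisfies the neighbor condition up to three steps. -/
def isCandidate (M : Fin 3 → Fin 4 → ℤ) : Bool :=
  ([0, 1, 2].all fun k => [0, 1, 2, 3].any fun i => decide (M k i ≠ 0)) && hasNeighbors 3 M

/-- The coordinate matrices with ordered columns and given heights. -/
def candidatesOfHeight (h : Triple) (C : List Triple) : List (Fin 3 → Fin 4 → ℤ) :=
  C.flatMap fun c₁ => C.flatMap fun c₂ =>
    -- The four ordered keys sum to the key of `h`, so `c₁ + 3c₂` cannot exceed it. The two missing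
    -- columns have totals at least -1, so the first two totals exceed that of `h` by at most 2. The
    -- constants 180000 and 12 also absorb the offsets 60000 and 10.
    if c₁.natKey ≤ c₂.natKey && c₁.natKey + 3 * c₂.natKey ≤ h.natKey + 180000 &&
        c₁.natTotal + c₂.natTotal ≤ h.natTotal + 12 then C.filterMap fun c₃ =>
      if c₂.natKey ≤ c₃.natKey && c₁.natKey + c₂.natKey + 2 * c₃.natKey ≤ h.natKey + 180000 &&
          c₁.natTotal + c₂.natTotal + c₃.natTotal ≤ h.natTotal + 21 then
        let c₄ : Triple := (h.1 - c₁.1 - c₂.1 - c₃.1, h.2.1 - c₁.2.1 - c₂.2.1 - c₃.2.1,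
          h.2.2 - c₁.2.2 - c₂.2.2 - c₃.2.2)
        if isColumn h c₄ && isCandidate (ofColumns c₁ c₂ c₃ c₄)
        then some (ofColumns c₁ c₂ c₃ c₄) else none
      else none
    else []

/-- All coordinate matrices to be considered. -/
def candidates : List (Fin 3 → Fin 4 → ℤ) :=
  heightList.flatMap fun h => candidatesOfHeight h (columns h)

/-- The coordinates of all vertices: the unit vectors, followed by the rows of `M`. -/
def frame (M : Fin 3 → Fin 4 → ℤ) : Fin 7 → Fin 4 → ℤ :=
  ![![1, 0, 0, 0], ![0, 1, 0, 0], ![0, 0, 1, 0], ![0, 0, 0, 1], M 0, M 1, M 2]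

/-- The numbering `σ` identifies the vectors `frame M` with those of `a`. -/
def Matches (M : Fin 3 → Fin 4 → ℤ) (a : Name) (σ : Fin 7 → Fin 7) : Prop :=
  σ.Injective ∧
    ∀ j m, frame M (σ j) m = ∑ i, a.stdVec j i * frame M (σ (a.type.base i)) m

instance (M : Fin 3 → Fin 4 → ℤ) (a : Name) (σ : Fin 7 → Fin 7) : Decidable (Matches M a σ) :=
  inferInstanceAs (Decidable (_ ∧ _))

/-- Decoding of a name from its position in the list. -/
def Name.ofNat (n : ℕ) : Name :=
  if n < 19 then .D (Fin.ofNat 19 n) else if n < 22 then .E (Fin.ofNat 3 (n - 19))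
  else .G (Fin.ofNat 6 (n - 22))

/-- Decoding of a numbering from its digits in base `7`. -/
def digits (n : ℕ) (j : Fin 7) : Fin 7 := Fin.ofNat 7 (n / 7 ^ j.val)

/-- For each candidate, the code of a name and a numbering matching it. -/
def matchCodes : List ℕ :=
  [15952516, 443211, 1151506, 2090297, 2913798, 18517897, 422001, 2774946, 18247039, 2069087,
   1245544, 16089646, 19416668, 21063796, 5128317, 13265347, 8328793, 20166375, 21202990,
   19898253, 8422489, 19555904, 17753370, 17400576, 20167425, 21203014, 16929995, 3638941,
   3622135, 7031555, 20164983, 4539716, 7716204, 7598946, 4540058, 6187144, 21337078, 6186802,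
   16913189, 17753538, 14695544, 13050858, 21895889, 10794676, 11623007, 12775488, 22984164,
   22160621, 15246117, 9403742, 9386936, 9168842, 9147632, 9246074, 9480974, 15519087, 10069617,
   15404235]

/-- All members of the list are matched by the corresponding code. -/
def allMatch : List (Fin 3 → Fin 4 → ℤ) → List ℕ → Bool
  | [], _ => true
  | _ :: _, [] => false
  | M :: L, n :: N => decide (Matches M (Name.ofNat (n / 7 ^ 7)) (digits n)) && allMatch L N

end FanoClassification

/-! ### Completeness of the enumeration -/

namespace FanoClassification

theorem mem_entries {h x : ℤ} (h₁ : h - 1 ≤ x) (h₂ : x ≤ 3 - 2 * h) : x ∈ entries h := by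
  simp only [entries, List.mem_map, List.mem_range]
  exact ⟨(x - (h - 1)).toNat, by omega, by omega⟩

theorem mem_columns {h c : Triple} (h₁ : c.1 ∈ entries h.1) (h₂ : c.2.1 ∈ entries h.2.1)
    (h₃ : c.2.2 ∈ entries h.2.2) (hc : isColumn h c = true) : c ∈ columns h := by
  simp only [columns, List.mem_flatMap, List.mem_filterMap]
  exact ⟨c.1, h₁, c.2.1, h₂, c.2.2, h₃, by simp [hc]⟩

theorem isNeighbor_iff {M : Fin 3 → Fin 4 → ℤ} {i : Fin 4} {k : Fin 3} :
    isNeighbor M i k = true ↔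
      M k i = -1 ∧ ∀ z, z ≠ k → (1 - height M k) * (-M z i) < 1 - height M z := by
  simp only [isNeighbor, Bool.and_eq_true, decide_eq_true_eq, List.all_eq_true, Bool.or_eq_true]
  refine and_congr_right fun _ => ⟨fun h z hz => (h z ?_).resolve_left hz, fun h z _ => ?_⟩
  · fin_cases z <;> simp
  · by_cases hz : z = k
    exacts [Or.inl hz, Or.inr (h z hz)]

theorem hasNeighbors_succ {n : ℕ} {M : Fin 3 → Fin 4 → ℤ} :
    hasNeighbors (n + 1) M = true ↔
      ∀ i, ∃ k, isNeighbor M i k = true ∧ hasNeighbors n (pivot M i k) = true := by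
  simp only [hasNeighbors, List.all_eq_true, List.any_eq_true, Bool.and_eq_true]
  refine ⟨fun h i => ?_, fun h i _ => ?_⟩
  · obtain ⟨k, -, hk⟩ := h i (by fin_cases i <;> simp)
    exact ⟨k, hk⟩
  · obtain ⟨k, hk⟩ := h i
    exact ⟨k, by fin_cases k <;> simp, hk⟩

/-- The `i`-th column of a coordinate matrix. -/
def column (M : Fin 3 → Fin 4 → ℤ) (i : Fin 4) : Triple := (M 0 i, M 1 i, M 2 i)

/-- The heights of a coordinate matrix. -/
def heights (M : Fin 3 → Fin 4 → ℤ) : Triple := (height M 0, height M 1, height M 2)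

theorem ofColumns_column (M : Fin 3 → Fin 4 → ℤ) :
    ofColumns (column M 0) (column M 1) (column M 2) (column M 3) = M := by
  ext k i
  fin_cases k <;> fin_cases i <;> rfl

/-- If `t < b`, then `-t ≥ 1 - b > 0`, and the factor `1 - a ≥ 1` cannot make the left side smaller.
-/
theorem neg_lt_of_mul_lt {a t b : ℤ} (ha : a ≤ 0) (hb : b ≤ 0) (h : (1 - a) * -t < 1 - b) :
    b ≤ t := by
  by_contra! hlt
  nlinarith [mul_nonneg (neg_nonneg.2 ha) (by omega : 0 ≤ -t)]

section Completeness

variable {M : Fin 3 → Fin 4 → ℤ} (hh : ∀ k, height M k ≤ 0)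
  (hs : ∀ i, -1 ≤ (column M i).total)
  (hN : ∀ i, ∃ k, isNeighbor M i k = true)

-- Either the entry belongs to the neighbor along its column and equals -1, or the strict inequality
-- defining the neighbor bounds it below by its height.
include hh hN in
theorem height_sub_one_le (k : Fin 3) (i : Fin 4) : height M k - 1 ≤ M k i := by
  obtain ⟨n, hn⟩ := hN i
  obtain ⟨h₁, h₂⟩ := isNeighbor_iff.1 hn
  by_cases hk : k = n
  · subst hk
    have := hh k
    omega
  · have := neg_lt_of_mul_lt (hh n) (hh k) (h₂ k hk)
    omega

-- An entry is the height minus three entries that are each at least `h - 1`, which gives the upper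
-- bound `3 - 2h`.
include hh hN in
theorem coordinate_mem_entries (k : Fin 3) (i : Fin 4) : M k i ∈ entries (height M k) := by
  have h := height_sub_one_le hh hN k
  have h0 := h 0
  have h1 := h 1
  have h2 := h 2
  have h3 := h 3
  refine mem_entries (h i) ?_
  simp only [height] at *
  fin_cases i <;> simp <;> omega

-- The heights and the column totals have the same sum, which is at least -4. The list therefore
-- consists of the negated partitions of 0, …, 4 into at most three parts.
include hs in
theorem heights_mem_heightList (hh : ∀ k, height M k ≤ 0) (h₁ : height M 1 ≤ height M 0)
    (h₂ : height M 2 ≤ height M 1) : heights M ∈ heightList := by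
  have h0 := hs 0
  have h1 := hs 1
  have h2 := hs 2
  have h3 := hs 3
  have g0 := hh 0
  have hsum : -4 ≤ height M 0 + height M 1 + height M 2 := by
    simp only [Triple.total, column, height] at *
    omega
  simp only [heights, heightList, List.mem_cons, Prod.mk.injEq, List.not_mem_nil, or_false]
  omega

include hs hN in
theorem isColumn_column (i : Fin 4) : isColumn (heights M) (column M i) = true := by
  obtain ⟨n, hn⟩ := hN i
  obtain ⟨h₁, h₂⟩ := isNeighbor_iff.1 hn
  have hle : (column M i).total ≤ (heights M).total + 3 := by
    have h0 := hs 0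
    have h1 := hs 1
    have h2 := hs 2
    have h3 := hs 3
    simp only [Triple.total, column, heights, height] at *
    fin_cases i <;> simp <;> omega
  simp only [isColumn, Bool.and_eq_true, decide_eq_true_eq, Bool.or_eq_true]
  refine ⟨⟨hs i, hle⟩, ?_⟩
  fin_cases n
  · exact Or.inl (Or.inl ⟨⟨h₁, h₂ 1 (by decide)⟩, h₂ 2 (by decide)⟩)
  · exact Or.inl (Or.inr ⟨⟨h₁, h₂ 0 (by decide)⟩, h₂ 2 (by decide)⟩)
  · exact Or.inr ⟨⟨h₁, h₂ 0 (by decide)⟩, h₂ 1 (by decide)⟩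

end Completeness

theorem mem_candidates {M : Fin 3 → Fin 4 → ℤ} (hh : ∀ k, height M k ≤ 0)
    (hmono : ∀ k l, k ≤ l → height M l ≤ height M k)
    (hs : ∀ i, -1 ≤ (column M i).total)
    (hkey : ∀ i j, i ≤ j → (column M i).key ≤ (column M j).key)
    (hM : ∀ k, M k ≠ 0) (hN : hasNeighbors 3 M = true) : M ∈ candidates := by
  have hN₁ : ∀ i, ∃ k, isNeighbor M i k = true := fun i =>
    let ⟨k, hk⟩ := hasNeighbors_succ.1 hN i
    ⟨k, hk.1⟩
  have hmem : ∀ i, column M i ∈ columns (heights M) := fun i =>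
    mem_columns (coordinate_mem_entries hh hN₁ 0 i) (coordinate_mem_entries hh hN₁ 1 i)
      (coordinate_mem_entries hh hN₁ 2 i) (isColumn_column hs hN₁ i)
  have hlist := heights_mem_heightList hs hh (hmono 0 1 (by decide)) (hmono 1 2 (by decide))
  refine List.mem_flatMap.2 ⟨heights M, hlist, ?_⟩
  have hb : ∀ k, -4 ≤ height M k ∧ height M k ≤ 0 := by
    intro k
    simp only [heights, heightList, List.mem_cons, Prod.mk.injEq, List.not_mem_nil, or_false]
      at hlist
    fin_cases k <;> simp <;> omega
  have hk₁ := hkey 0 1 (by decide)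
  have hk₂ := hkey 1 2 (by decide)
  have hk₃ := hkey 2 3 (by decide)
  have hlow : ∀ k i, -5 ≤ M k i := fun k i => by
    have := height_sub_one_le hh hN₁ k i
    have := hb k
    omega
  -- Entries and heights are at least -5, so the offset 60000 makes every key nonnegative and
  -- `toNat` loses nothing.
  have hkey0 : ∀ i, -60000 ≤ (column M i).key ∧ (column M i).key ≤ (heights M).key + 180000 ∧
      -60000 ≤ (heights M).key := by
    intro i
    have e0 := coordinate_mem_entries hh hN₁ 0 i
    have l0 := hlow 0 i
    have l1 := hlow 1 i
    have l2 := hlow 2 i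
    have b0 := hb 0
    have b1 := hb 1
    have b2 := hb 2
    have := hlow 0
    have up : ∀ k, M k i ≤ 11 := by
      intro k
      have h0 := height_sub_one_le hh hN₁ k 0
      have h1 := height_sub_one_le hh hN₁ k 1
      have h2 := height_sub_one_le hh hN₁ k 2
      have h3 := height_sub_one_le hh hN₁ k 3
      have hk := hb k
      simp only [height] at h0 h1 h2 h3 hk
      fin_cases i <;> simp <;> omega
    have u0 := up 0
    have u1 := up 1
    have u2 := up 2
    simp only [column, heights, Triple.key] at *
    omega
  have k0 := hkey0 0
  have k1 := hkey0 1
  have k2 := hkey0 2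
  have k3 := hkey0 3
  have hsumkey : (column M 0).key + (column M 1).key + (column M 2).key + (column M 3).key =
      (heights M).key := by
    simp only [column, heights, Triple.key, height]
    ring
  have hsumtotal : (column M 0).total + (column M 1).total + (column M 2).total +
      (column M 3).total = (heights M).total := by
    simp only [column, heights, Triple.total, height]
    ring
  have t0 := hs 0
  have t1 := hs 1
  have t2 := hs 2
  have t3 := hs 3
  simp only [candidatesOfHeight, List.mem_flatMap]
  refine ⟨column M 0, hmem 0, column M 1, hmem 1, ?_⟩
  rw [if_pos]
  swap
  · simp only [Bool.and_eq_true, decide_eq_true_eq]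
    simp only [Triple.natKey, Triple.natTotal]
    omega
  refine List.mem_filterMap.2 ⟨column M 2, hmem 2, ?_⟩
  rw [if_pos]
  swap
  · simp only [Bool.and_eq_true, decide_eq_true_eq]
    simp only [Triple.natKey, Triple.natTotal]
    omega
  have hc : ((heights M).1 - (column M 0).1 - (column M 1).1 - (column M 2).1,
      (heights M).2.1 - (column M 0).2.1 - (column M 1).2.1 - (column M 2).2.1,
      (heights M).2.2 - (column M 0).2.2 - (column M 1).2.2 - (column M 2).2.2) = column M 3 := by
    simp only [heights, column, height, Prod.mk.injEq]
    refine ⟨by ring, by ring, by ring⟩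
  simp only [hc, ofColumns_column, isColumn_column hs hN₁ 3, Bool.true_and]
  rw [if_pos]
  simp only [isCandidate, hN, Bool.and_true, List.all_eq_true, List.any_eq_true,
    decide_eq_true_eq]
  intro k _
  obtain ⟨i, hi⟩ := Function.ne_iff.1 (hM k)
  exact ⟨i, by fin_cases i <;> simp, hi⟩

theorem exists_matches_of_allMatch {L : List (Fin 3 → Fin 4 → ℤ)} {N : List ℕ}
    (h : allMatch L N = true) {M : Fin 3 → Fin 4 → ℤ} (hM : M ∈ L) : ∃ a σ, Matches M a σ := by
  induction L generalizing N with
  | nil => simp at hM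
  | cons M' L ih =>
    cases N with
    | nil => simp [allMatch] at h
    | cons n N =>
      simp only [allMatch, Bool.and_eq_true, decide_eq_true_eq] at h
      rcases List.mem_cons.1 hM with rfl | hM
      exacts [⟨_, _, h.1⟩, ih h.2 hM]

-- The finite computation behind the classification; it also shows that adjacency conditions of
-- depth three are enough to exclude all spurious matrices.
set_option maxRecDepth 100000 in
theorem allMatch_candidates : allMatch candidates matchCodes = true := by decide +kernel

end FanoClassification

/-! ### Supporting functionals and facets -/

namespace FanoClassification

variable {d : ℕ}

/-- A convex polytope with the origin in its interior. -/
structure IsCentered (P : Set (Fin d → ℝ)) : Prop where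
  polytope : ∃ s : Set (Fin d → ℝ), s.Finite ∧ P = convexHull ℝ s
  zero_mem : (0 : Fin d → ℝ) ∈ interior P

theorem IsFanoPolyhedron.isCentered {P : Set (Fin d → ℝ)} (hP : IsFanoPolyhedron P) :
    IsCentered P :=
  ⟨hP.polytope, hP.zero_mem⟩

namespace IsCentered

variable {P : Set (Fin d → ℝ)} (hP : IsCentered P)

include hP

theorem finite_vertices : (vertices P).Finite := by
  obtain ⟨s, hs, rfl⟩ := hP.polytope
  exact hs.subset extremePoints_convexHull_subset

theorem convex : Convex ℝ P := by
  obtain ⟨s, -, rfl⟩ := hP.polytope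
  exact convex_convexHull ℝ s

theorem isCompact : IsCompact P := by
  obtain ⟨s, hs, rfl⟩ := hP.polytope
  exact hs.isCompact_convexHull ℝ

theorem convexHull_vertices : convexHull ℝ (vertices P) = P := by
  rw [← (hP.finite_vertices.isClosed_convexHull ℝ).closure_eq]
  exact closure_convexHull_extremePoints hP.isCompact hP.convex

theorem convexHull_vertices_of_isExposed {F : Set (Fin d → ℝ)} (hF : IsExposed ℝ P F) :
    convexHull ℝ (vertices F) = F := by
  have hfin : (vertices F).Finite := hP.finite_vertices.subset
    hF.isExtreme.extremePoints_subset_extremePoints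
  rw [← (hfin.isClosed_convexHull ℝ).closure_eq]
  exact closure_convexHull_extremePoints (hF.isCompact hP.isCompact) (hF.convex hP.convex)

theorem le_of_mem {l : (Fin d → ℝ) →ₗ[ℝ] ℝ} {c : ℝ} (hl : ∀ v ∈ vertices P, l v ≤ c)
    {x : Fin d → ℝ} (hx : x ∈ P) : l x ≤ c := by
  rw [← hP.convexHull_vertices] at hx
  exact convexHull_min (t := {x | l x ≤ c}) hl (convex_halfSpace_le l.isLinear c) hx

theorem exists_smul_mem (x : Fin d → ℝ) : ∃ t : ℝ, 0 < t ∧ t • x ∈ P := by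
  have hP0 : P ∈ nhds (0 : Fin d → ℝ) := mem_interior_iff_mem_nhds.1 hP.zero_mem
  have hc : Filter.Tendsto (fun t : ℝ => t • x) (nhdsWithin 0 (Set.Ioi 0)) (nhds 0) := by
    have : Continuous fun t : ℝ => t • x := by fun_prop
    simpa using (this.tendsto 0).mono_left nhdsWithin_le_nhds
  obtain ⟨t, ht, ht'⟩ := ((hc.eventually hP0).and self_mem_nhdsWithin).exists
  exact ⟨t, ht', ht⟩

/-- Every direction has a positive multiple in `P`, so a functional that is nonpositive on the
vertices is nonpositive everywhere, hence zero. -/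
theorem exists_pos_of_ne_zero {l : (Fin d → ℝ) →ₗ[ℝ] ℝ} (hl : l ≠ 0) :
    ∃ v ∈ vertices P, 0 < l v := by
  by_contra! h
  refine hl (LinearMap.ext fun x => ?_)
  have key : ∀ y, l y ≤ 0 := fun y => by
    obtain ⟨t, ht, hty⟩ := hP.exists_smul_mem y
    have := hP.le_of_mem h hty
    rw [map_smul, smul_eq_mul] at this
    exact nonpos_of_mul_nonpos_right this ht
  have h₁ := key x
  have h₂ := key (-x)
  rw [map_neg] at h₂
  exact le_antisymm h₁ (neg_nonpos.1 h₂)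

theorem zero_mem' : (0 : Fin d → ℝ) ∈ P := interior_subset hP.zero_mem

/-- A nonempty proper face is cut out by a functional with maximum `1`. -/
theorem exists_functional_of_isProperFace {F : Set (Fin d → ℝ)} (hF : IsProperFace P F)
    (hne : F.Nonempty) :
    ∃ l : (Fin d → ℝ) →ₗ[ℝ] ℝ, (∀ x ∈ P, l x ≤ 1) ∧ F = {x ∈ P | l x = 1} := by
  obtain ⟨l, hl⟩ := hF.1 hne
  obtain ⟨x₀, hx₀⟩ := hne
  have hx₀' := hx₀
  rw [hl] at hx₀'
  have hpos : 0 < l x₀ := by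
    -- A maximum of 0 would force the functional to vanish identically and the face to be all of
    -- `P`.
    refine lt_of_le_of_ne (by simpa using hx₀'.2 0 hP.zero_mem') fun h0 => hF.2 ?_
    have hl0 : (l : (Fin d → ℝ) →ₗ[ℝ] ℝ) = 0 := by
      by_contra hne
      obtain ⟨v, hv, hv'⟩ := hP.exists_pos_of_ne_zero hne
      have := hx₀'.2 v (extremePoints_subset hv)
      simp only [ContinuousLinearMap.coe_coe] at hv'
      linarith
    have hl0' : ∀ x, l x = 0 := fun x => by simpa using LinearMap.congr_fun hl0 x
    rw [hl]
    ext x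
    simp [hl0']
  refine ⟨(l x₀)⁻¹ • (l : (Fin d → ℝ) →ₗ[ℝ] ℝ), fun x hx => ?_, ?_⟩
  · have := hx₀'.2 x hx
    simp only [LinearMap.smul_apply, ContinuousLinearMap.coe_coe, smul_eq_mul]
    rw [inv_mul_le_iff₀ hpos]
    simpa using this
  · rw [hl]
    ext x
    simp only [Set.mem_ofPred_eq, LinearMap.smul_apply, ContinuousLinearMap.coe_coe, smul_eq_mul]
    refine and_congr_right fun hx => ?_
    rw [inv_mul_eq_one₀ hpos.ne']
    exact ⟨fun h => le_antisymm (h x₀ hx₀'.1) (hx₀'.2 x hx), fun h y hy => h ▸ hx₀'.2 y hy⟩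

omit hP in
theorem isExposed_of_le_one {l : (Fin d → ℝ) →ₗ[ℝ] ℝ} (hl : ∀ x ∈ P, l x ≤ 1) :
    IsExposed ℝ P {x ∈ P | l x = 1} := by
  rintro ⟨x₀, hx₀, h₀⟩
  refine ⟨LinearMap.toContinuousLinearMap l, ?_⟩
  ext x
  simp only [Set.mem_ofPred_eq, LinearMap.coe_toContinuousLinearMap']
  refine and_congr_right fun hx => ⟨fun h y hy => h ▸ hl y hy, fun h => ?_⟩
  exact le_antisymm (hl x hx) (h₀ ▸ h x₀ hx₀)

theorem isProperFace_of_le_one {l : (Fin d → ℝ) →ₗ[ℝ] ℝ} (hl : ∀ x ∈ P, l x ≤ 1) :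
    IsProperFace P {x ∈ P | l x = 1} := by
  refine ⟨isExposed_of_le_one hl, fun h => ?_⟩
  have := hP.zero_mem'
  rw [← h] at this
  simp at this

end IsCentered

theorem vertices_of_isExposed {P F : Set (Fin d → ℝ)} (hF : IsExposed ℝ P F) :
    vertices F = F ∩ vertices P :=
  hF.isExtreme.extremePoints_eq

/-- The vertices on which a functional takes the value `1`. -/
def tight (P : Set (Fin d → ℝ)) (l : (Fin d → ℝ) →ₗ[ℝ] ℝ) : Set (Fin d → ℝ) :=
  {v ∈ vertices P | l v = 1}

/-- The functional `l` is `1` on a facet of `P` and at most `1` on `P`. -/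
structure IsFacetFunctional (P : Set (Fin d → ℝ)) (l : (Fin d → ℝ) →ₗ[ℝ] ℝ) : Prop where
  le_one : ∀ v ∈ vertices P, l v ≤ 1
  span_tight : Submodule.span ℝ (tight P l) = ⊤

theorem finrank_stdLattice : Module.finrank ℤ (stdLattice d) = d := by
  have : LinearIndependent ℤ (Pi.basisFun ℝ (Fin d)) :=
    (Pi.basisFun ℝ (Fin d)).linearIndependent.restrict_scalars (by
      intro a b h
      simpa using h)
  exact (finrank_span_eq_card this).trans (Fintype.card_fin d)

theorem span_real_eq_top_of_stdLattice_le {W : Set (Fin d → ℝ)}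
    (h : stdLattice d ≤ Submodule.span ℤ W) : Submodule.span ℝ W = ⊤ := by
  rw [eq_top_iff, ← (Pi.basisFun ℝ (Fin d)).span_eq, Submodule.span_le]
  intro x hx
  have := h (Submodule.subset_span hx)
  exact Submodule.span_le_restrictScalars ℤ ℝ W this

theorem IsLatticeBasis.finite {W : Set (Fin d → ℝ)} (h : IsLatticeBasis W) (hW : W.Finite) :
    W.ncard = d := by
  have := hW.fintype
  have h₁ : Module.finrank ℤ (Submodule.span ℤ W) = W.toFinset.card := by
    apply finrank_span_set_eq_card
    exact h.1
  rw [h.2, finrank_stdLattice] at h₁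
  rw [Set.ncard_eq_toFinset_card', ← h₁]

theorem linearIndependent_real_of_span {c : Fin d → Fin d → ℝ}
    (h : Submodule.span ℝ (Set.range c) = ⊤) : LinearIndependent ℝ c :=
  linearIndependent_of_top_le_span_of_card_eq_finrank h.ge (by simp)

theorem mem_stdLattice_iff {x : Fin d → ℝ} : x ∈ stdLattice d ↔ ∀ i, ∃ n : ℤ, x i = n := by
  rw [stdLattice, Module.Basis.mem_span_iff_repr_mem]
  simp [eq_comm]

namespace IsFanoPolyhedron

variable {P : Set (Fin d → ℝ)}

/-- The tight vertices span the space, so the differences of points of the face fill the kernel of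
`l`. The face thus has dimension `d - 1` and unimodularity applies. -/
theorem isLatticeBasis_tight (hP : IsFanoPolyhedron P) (hd : 0 < d)
    {l : (Fin d → ℝ) →ₗ[ℝ] ℝ} (hl : IsFacetFunctional P l) : IsLatticeBasis (tight P l) := by
  have hle : ∀ x ∈ P, l x ≤ 1 := fun x => hP.isCentered.le_of_mem hl.le_one
  have hexp := IsCentered.isExposed_of_le_one hle
  have hvert : vertices {x ∈ P | l x = 1} = tight P l := by
    rw [vertices_of_isExposed hexp]
    ext x
    simp only [tight, Set.mem_inter_iff, Set.mem_ofPred_eq]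
    exact ⟨fun h => ⟨h.2, h.1.2⟩, fun h => ⟨⟨extremePoints_subset h.1, h.2⟩, h.1⟩⟩
  obtain ⟨k, rfl⟩ : ∃ k, d = k + 1 := ⟨d - 1, by omega⟩
  have hne : (tight P l).Nonempty := by
    by_contra h
    have := hl.span_tight
    rw [Set.not_nonempty_iff_eq_empty.1 h, Submodule.span_empty] at this
    exact bot_ne_top this
  obtain ⟨x₀, hx₀⟩ := hne
  have hl0 : l ≠ 0 := by
    rintro rfl
    simpa using hx₀.2
  rw [← hvert]
  refine hP.unimodular _ k rfl ⟨hexp, ⟨x₀, extremePoints_subset hx₀.1, hx₀.2⟩, ?_⟩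
  have hker := Module.Dual.finrank_ker_add_one_of_ne_zero (K := ℝ) (f := l) hl0
  have hspan : vectorSpan ℝ {x ∈ P | l x = 1} ≤ LinearMap.ker l := by
    rw [vectorSpan_def, Submodule.span_le]
    rintro _ ⟨x, hx, y, hy, rfl⟩
    simp [hx.2, hy.2]
  have hle' : LinearMap.ker l ≤ vectorSpan ℝ {x ∈ P | l x = 1} := by
    -- Projection to the kernel along `x₀`; on tight vertices it is a difference of two points of
    -- the face.
    have hdec : ∀ x : Fin (k + 1) → ℝ, x - l x • x₀ ∈ vectorSpan ℝ {x ∈ P | l x = 1} := by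
      intro x
      have hx : x ∈ Submodule.span ℝ (tight P l) := hl.span_tight ▸ Submodule.mem_top
      induction hx using Submodule.span_induction with
      | mem x hx =>
        rw [hx.2, one_smul]
        exact vsub_mem_vectorSpan ℝ ⟨extremePoints_subset hx.1, hx.2⟩
          ⟨extremePoints_subset hx₀.1, hx₀.2⟩
      | zero => simp
      | add x y _ _ hx hy =>
        convert Submodule.add_mem _ hx hy using 1
        rw [map_add, add_smul]
        abel
      | smul a x _ hx =>
        convert Submodule.smul_mem _ a hx using 1
        rw [map_smul, smul_sub, smul_eq_mul, mul_smul]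
    intro x hx
    simpa [LinearMap.mem_ker.1 hx] using hdec x
  rw [le_antisymm hspan hle']
  simpa using hker

/-- A facet has exactly `d` vertices, so `d` independent tight vertices are all of them. -/
theorem tight_eq_range (hP : IsFanoPolyhedron P) (hd : 0 < d) {l : (Fin d → ℝ) →ₗ[ℝ] ℝ}
    (hle : ∀ v ∈ vertices P, l v ≤ 1) {c : Fin d → Fin d → ℝ} (hc : ∀ i, c i ∈ tight P l)
    (hspan : Submodule.span ℝ (Set.range c) = ⊤) :
    IsFacetFunctional P l ∧ tight P l = Set.range c ∧
      Submodule.span ℤ (Set.range c) = stdLattice d := by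
  have hsub : Set.range c ⊆ tight P l := Set.range_subset_iff.2 hc
  have hl : IsFacetFunctional P l := ⟨hle, top_le_iff.1 (hspan.ge.trans (Submodule.span_mono hsub))⟩
  have hb := hP.isLatticeBasis_tight hd hl
  have hfin : (tight P l).Finite := hP.isCentered.finite_vertices.subset fun _ h => h.1
  have hcard : (Set.range c).ncard = d := by
    rw [Set.ncard_range_of_injective (linearIndependent_real_of_span hspan).injective]
    simp
  have heq : Set.range c = tight P l :=
    Set.eq_of_subset_of_ncard_le hsub (by rw [hb.finite hfin, hcard]) hfin
  exact ⟨hl, heq.symm, heq ▸ hb.2⟩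

/-- Moving a supporting functional until it becomes tight at a further vertex. -/
theorem _root_.FanoClassification.IsCentered.exists_tight (hP : IsCentered P)
    {l w : (Fin d → ℝ) →ₗ[ℝ] ℝ} (hl : ∀ v ∈ vertices P, l v ≤ 1) (hw : w ≠ 0) :
    ∃ t : ℝ, 0 ≤ t ∧ (∀ v ∈ vertices P, (l + t • w) v ≤ 1) ∧
      ∃ v ∈ vertices P, 0 < w v ∧ (l + t • w) v = 1 := by
  obtain ⟨v₀, hv₀, hv₀'⟩ := hP.exists_pos_of_ne_zero hw
  -- The first vertex reached is the one with the smallest ratio of slack to speed.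
  obtain ⟨v, ⟨hv, hwv⟩, hmin⟩ := Set.exists_min_image {v ∈ vertices P | 0 < w v}
    (fun v => (1 - l v) / w v) (hP.finite_vertices.subset fun _ h => h.1) ⟨v₀, hv₀, hv₀'⟩
  have ht : 0 ≤ (1 - l v) / w v := div_nonneg (by linarith [hl v hv]) hwv.le
  refine ⟨(1 - l v) / w v, ht, fun u hu => ?_, v, hv, hwv, ?_⟩
  · simp only [LinearMap.add_apply, LinearMap.smul_apply, smul_eq_mul]
    rcases lt_or_ge 0 (w u) with h | h
    · have := hmin u ⟨hu, h⟩
      rw [le_div_iff₀ h] at this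
      linarith
    · have := mul_nonpos_of_nonneg_of_nonpos ht h
      linarith [hl u hu]
  · simp only [LinearMap.add_apply, LinearMap.smul_apply, smul_eq_mul]
    field_simp
    ring

/-- Take a supporting functional whose tight vertices span a space of largest dimension. If this
space were proper, moving along a functional that vanishes on it would keep the old tight vertices
and add an independent one. -/
theorem _root_.FanoClassification.IsCentered.exists_isFacetFunctional (hP : IsCentered P) :
    ∃ l, IsFacetFunctional P l := by
  have hex : ∃ n, ∃ l : (Fin d → ℝ) →ₗ[ℝ] ℝ, (∀ v ∈ vertices P, l v ≤ 1) ∧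
      d - Module.finrank ℝ (Submodule.span ℝ (tight P l)) = n := ⟨_, 0, by simp, rfl⟩
  classical
  obtain ⟨l, hl, hn⟩ := Nat.find_spec hex
  refine ⟨l, hl, ?_⟩
  by_contra hne
  obtain ⟨w, hw, hker⟩ := Submodule.exists_le_ker_of_lt_top _ (lt_top_iff_ne_top.2 hne)
  obtain ⟨t, -, ht, v, hv, hwv, hv1⟩ := hP.exists_tight hl hw
  have hsub : tight P l ⊆ tight P (l + t • w) := fun x hx => by
    have : w x = 0 := hker (Submodule.subset_span hx)
    exact ⟨hx.1, by simp [this, hx.2]⟩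
  have hlt : Submodule.span ℝ (tight P l) < Submodule.span ℝ (tight P (l + t • w)) := by
    refine lt_of_le_of_ne (Submodule.span_mono hsub) fun h => ?_
    have : v ∈ Submodule.span ℝ (tight P l) := h ▸ Submodule.subset_span ⟨hv, hv1⟩
    have : w v = 0 := hker this
    linarith
  have h₁ := Submodule.finrank_lt_finrank_of_lt hlt
  have h₂ := Submodule.finrank_le (Submodule.span ℝ (tight P (l + t • w)))
  rw [Module.finrank_fin_fun] at h₂
  have h₃ := Nat.find_min' hex ⟨l + t • w, ht, rfl⟩
  omega

end IsFanoPolyhedron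

end FanoClassification

/-! ### Facet bases, adjacent facets and the special facet -/

namespace FanoClassification

open Module

variable {d : ℕ}

/-- The functional that is `1` on a basis. -/
noncomputable def facetForm (b : Basis (Fin d) ℝ (Fin d → ℝ)) : (Fin d → ℝ) →ₗ[ℝ] ℝ := ∑ i, b.coord i

theorem facetForm_apply (b : Basis (Fin d) ℝ (Fin d → ℝ)) (x : Fin d → ℝ) :
    facetForm b x = ∑ i, b.repr x i := by
  simp [facetForm]

theorem facetForm_self (b : Basis (Fin d) ℝ (Fin d → ℝ)) (i : Fin d) : facetForm b (b i) = 1 := by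
  simp [facetForm_apply, Finsupp.single_apply]

theorem facetForm_eq {b : Basis (Fin d) ℝ (Fin d → ℝ)} {l : (Fin d → ℝ) →ₗ[ℝ] ℝ}
    (h : ∀ i, l (b i) = 1) : facetForm b = l :=
  b.ext fun i => by rw [facetForm_self, h]

/-- The vectors of `b` are the vertices of a facet of `P`, and they span the lattice. -/
structure IsFacetBasis (P : Set (Fin d → ℝ)) (b : Basis (Fin d) ℝ (Fin d → ℝ)) : Prop where
  le_one : ∀ v ∈ vertices P, facetForm b v ≤ 1
  tight_eq : tight P (facetForm b) = Set.range b
  span_eq : Submodule.span ℤ (Set.range b) = stdLattice d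

namespace IsFacetBasis

variable {P : Set (Fin d → ℝ)} {b : Basis (Fin d) ℝ (Fin d → ℝ)}

theorem mem_vertices (hb : IsFacetBasis P b) (i : Fin d) : b i ∈ vertices P := by
  have : b i ∈ tight P (facetForm b) := hb.tight_eq ▸ Set.mem_range_self i
  exact this.1

theorem lt_one (hb : IsFacetBasis P b) {v : Fin d → ℝ} (hv : v ∈ vertices P)
    (hvb : v ∉ Set.range b) : facetForm b v < 1 :=
  lt_of_le_of_ne (hb.le_one v hv) fun h => hvb (hb.tight_eq ▸ ⟨hv, h⟩)

theorem exists_int (hb : IsFacetBasis P b) {v : Fin d → ℝ} (hv : v ∈ stdLattice d) (i : Fin d) :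
    ∃ n : ℤ, b.repr v i = n := by
  rw [← hb.span_eq, Basis.mem_span_iff_repr_mem] at hv
  obtain ⟨n, hn⟩ := hv i
  exact ⟨n, hn.symm⟩

theorem isFacetFunctional (hb : IsFacetBasis P b) : IsFacetFunctional P (facetForm b) :=
  ⟨hb.le_one, hb.tight_eq ▸ b.span_eq⟩

end IsFacetBasis

namespace IsFanoPolyhedron

variable {P : Set (Fin d → ℝ)}

theorem exists_isFacetBasis_of_forall_mem (hP : IsFanoPolyhedron P) (hd : 0 < d)
    {l : (Fin d → ℝ) →ₗ[ℝ] ℝ} (hle : ∀ v ∈ vertices P, l v ≤ 1) {c : Fin d → Fin d → ℝ}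
    (hc : ∀ i, c i ∈ tight P l) (hspan : Submodule.span ℝ (Set.range c) = ⊤) :
    ∃ b : Basis (Fin d) ℝ (Fin d → ℝ), ⇑b = c ∧ facetForm b = l ∧ IsFacetBasis P b := by
  obtain ⟨-, h₂, h₃⟩ := hP.tight_eq_range hd hle hc hspan
  let b := Basis.mk (linearIndependent_real_of_span hspan) hspan.ge
  have hb : ⇑b = c := Basis.coe_mk _ _
  have hf : facetForm b = l := facetForm_eq fun i => by rw [hb]; exact (hc i).2
  refine ⟨b, hb, hf, ?_, ?_, ?_⟩
  · rwa [hf]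
  · rw [hf, hb, h₂]
  · rw [hb, h₃]

theorem exists_isFacetBasis (hP : IsFanoPolyhedron P) (hd : 0 < d) {l : (Fin d → ℝ) →ₗ[ℝ] ℝ}
    (hl : IsFacetFunctional P l) :
    ∃ b : Basis (Fin d) ℝ (Fin d → ℝ), facetForm b = l ∧ IsFacetBasis P b := by
  have hfin : (tight P l).Finite := hP.isCentered.finite_vertices.subset fun _ h => h.1
  have hcard := (hP.isLatticeBasis_tight hd hl).finite hfin
  have := hfin.to_subtype
  have e : Fin d ≃ tight P l := (Finite.equivFinOfCardEq (by
    rw [Nat.card_coe_set_eq, hcard])).symm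
  have hr : Set.range (fun i => (e i : Fin d → ℝ)) = tight P l := 
    (EquivLike.range_comp Subtype.val e).trans Subtype.range_coe
  obtain ⟨b, -, h₂, h₃⟩ := hP.exists_isFacetBasis_of_forall_mem hd hl.le_one
    (c := fun i => e i) (fun i => (e i).2) (by rw [hr, hl.span_tight])
  exact ⟨b, h₂, h₃⟩

/-- The facet adjacent to a facet with basis `b` along the ridge omitting `b i`. -/
theorem exists_neighbor (hP : IsFanoPolyhedron P) (hd : 0 < d)
    {b : Basis (Fin d) ℝ (Fin d → ℝ)} (hb : IsFacetBasis P b) (i : Fin d) :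
    ∃ n ∈ vertices P, n ∉ Set.range b ∧ b.repr n i = -1 ∧
      (∀ v ∈ vertices P, v ∉ Set.range b → v ≠ n →
        (1 - facetForm b n) * (-b.repr v i) < 1 - facetForm b v) ∧
      ∃ b' : Basis (Fin d) ℝ (Fin d → ℝ), ⇑b' = Function.update b i n ∧ IsFacetBasis P b' ∧
        facetForm b' = facetForm b - (1 - facetForm b n) • b.coord i := by
  have hw : -b.coord i ≠ 0 := fun h => by
    have := LinearMap.congr_fun h (b i)
    simp at this
  obtain ⟨t, -, hle, n, hn, hneg, htight⟩ := hP.isCentered.exists_tight hb.le_one hw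
  simp only [LinearMap.neg_apply, Basis.coord_apply] at hneg
  have hnb : n ∉ Set.range b := by
    rintro ⟨j, rfl⟩
    rcases eq_or_ne j i with rfl | hj
    · rw [Basis.repr_self, Finsupp.single_eq_same] at hneg
      linarith
    · simp [hj] at hneg
  set l := facetForm b + t • -b.coord i with hl
  have hc : ∀ j, Function.update b i n j ∈ tight P l := by
    intro j
    rcases eq_or_ne j i with rfl | hj
    · simpa using ⟨hn, htight⟩
    · rw [Function.update_of_ne hj]
      refine ⟨hb.mem_vertices j, ?_⟩
      simp [hl, facetForm_self, hj]
  have hspan : Submodule.span ℝ (Set.range (Function.update b i n)) = ⊤ := by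
    set W := Submodule.span ℝ (Set.range (Function.update b i n)) with hW
    have hj : ∀ j, j ≠ i → b j ∈ W := fun j hj =>
      Submodule.subset_span ⟨j, Function.update_of_ne hj _ _⟩
    have hnW : n ∈ W := Submodule.subset_span ⟨i, Function.update_self _ _ _⟩
    rw [eq_top_iff, ← b.span_eq, Submodule.span_le]
    rintro _ ⟨j, rfl⟩
    rcases eq_or_ne j i with rfl | hji
    · have hsum := b.sum_repr n
      rw [← Finset.add_sum_erase _ _ (Finset.mem_univ j)] at hsum
      have hmem : b.repr n j • b j ∈ W := by
        rw [eq_sub_of_add_eq hsum]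
        exact W.sub_mem hnW (W.sum_mem fun k hk => W.smul_mem _ (hj k (Finset.ne_of_mem_erase hk)))
      exact (W.smul_mem_iff (by linarith)).1 hmem
    · exact hj j hji
  obtain ⟨b', hb', hf, hfb⟩ := hP.exists_isFacetBasis_of_forall_mem hd hle hc hspan
  have hrepr : b.repr n i = -1 := by
    obtain ⟨k, hk⟩ := hb.exists_int (hP.integral n hn) i
    -- On the lattice spanned by the new facet, the `i`-th coordinate takes only integer multiples
    -- of that of `n`. Since `b i` lies in this lattice and has coordinate 1, the coordinate of `n`
    -- is a unit; being negative, it is -1.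
    have hz : ∀ x ∈ Submodule.span ℤ (Set.range (Function.update b i n)),
        ∃ m : ℤ, b.repr x i = m * b.repr n i := by
      intro x hx
      induction hx using Submodule.span_induction with
      | mem x hx =>
        obtain ⟨j, rfl⟩ := hx
        rcases eq_or_ne j i with rfl | hj
        · exact ⟨1, by simp⟩
        · exact ⟨0, by simp [hj]⟩
      | zero => exact ⟨0, by simp⟩
      | add x y _ _ hx hy =>
        obtain ⟨p, hp⟩ := hx
        obtain ⟨q, hq⟩ := hy
        exact ⟨p + q, by simp [hp, hq, add_mul]⟩
      | smul a x _ hx =>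
        obtain ⟨p, hp⟩ := hx
        refine ⟨a * p, ?_⟩
        rw [← Int.cast_smul_eq_zsmul ℝ a x, map_smul]
        simp [hp, mul_assoc]
    obtain ⟨m, hm⟩ := hz (b i) (by
      rw [← hb', hfb.span_eq, ← hb.span_eq]
      exact Submodule.subset_span ⟨i, rfl⟩)
    rw [hk] at hm hneg ⊢
    simp only [Basis.repr_self, Finsupp.single_eq_same] at hm
    have h₁ : m * k = 1 := by exact_mod_cast hm.symm
    have h₂ : k < 0 := by
      have : (k : ℝ) < 0 := by linarith
      exact_mod_cast this
    rcases Int.isUnit_iff.1 (IsUnit.of_mul_eq_one m (by rw [mul_comm]; exact h₁)) with h | h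
    · omega
    · rw [h]; simp
  have htn : t = 1 - facetForm b n := by
    simp only [hl, LinearMap.add_apply, LinearMap.smul_apply, LinearMap.neg_apply,
      Basis.coord_apply, hrepr, smul_eq_mul] at htight
    linarith
  have hl' : l = facetForm b - (1 - facetForm b n) • b.coord i := by
    rw [hl, ← htn, smul_neg, sub_eq_add_neg]
  refine ⟨n, hn, hnb, hrepr, fun v hv hvb hvn => ?_, b', hb', hfb, hf.trans hl'⟩
  have hlt : l v < 1 := by
    rw [← hf]
    refine hfb.lt_one hv ?_
    rw [hb']
    rintro ⟨j, rfl⟩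
    rcases eq_or_ne j i with rfl | hj
    · exact hvn (Function.update_self _ _ _)
    · exact hvb ⟨j, (Function.update_of_ne hj _ _).symm⟩
  rw [hl'] at hlt
  simp only [LinearMap.sub_apply, LinearMap.smul_apply, Basis.coord_apply, smul_eq_mul] at hlt
  linarith

/-- Some facet has the sum of all vertices in its cone. -/
theorem exists_special_facet (hP : IsFanoPolyhedron P) (hd : 0 < d) :
    ∃ b : Basis (Fin d) ℝ (Fin d → ℝ), IsFacetBasis P b ∧
      ∀ i, 0 ≤ b.repr (∑ v ∈ hP.isCentered.finite_vertices.toFinset, v) i := by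
  set s := ∑ v ∈ hP.isCentered.finite_vertices.toFinset, v
  -- A facet functional is determined by its tight vertices, since these span.
  have hfin : {l | IsFacetFunctional P l}.Finite := by
    refine Set.Finite.of_injOn (f := tight P) (t := 𝒫 (vertices P)) (fun l _ v hv => hv.1) ?_
      hP.isCentered.finite_vertices.finite_subsets
    intro l hl l' _ h
    refine LinearMap.ext_on hl.span_tight fun v hv => ?_
    have hv' : v ∈ tight P l' := by
      rw [← h]
      exact hv
    rw [hv.2, hv'.2]
  obtain ⟨l, hl, hmax⟩ := Set.exists_max_image _ (fun l => l s) hfin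
    hP.isCentered.exists_isFacetFunctional
  obtain ⟨b, rfl, hb⟩ := hP.exists_isFacetBasis hd hl
  refine ⟨b, hb, fun i => ?_⟩
  obtain ⟨n, hn, hnb, -, -, b', -, hb', hf⟩ := hP.exists_neighbor hd hb i
  -- The two functionals differ at `s` by a positive multiple of the `i`-th coordinate of `s`.
  have := hmax _ hb'.isFacetFunctional
  simp only [hf, LinearMap.sub_apply, LinearMap.smul_apply, Basis.coord_apply, smul_eq_mul] at this
  have h₁ := hb.lt_one hn hnb
  have h₂ : 0 ≤ (1 - facetForm b n) * b.repr s i := by linarith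
  exact nonneg_of_mul_nonneg_right h₂ (by linarith)

end IsFanoPolyhedron

end FanoClassification

/-! ### Coordinates with respect to a special facet -/

namespace FanoClassification

open Module

/-- The vertices of `P` are those of a facet with basis `b` and three more vertices `o`, whose
coordinates are the rows of `M`. -/
structure IsCoordinates (P : Set (Fin 4 → ℝ)) (b : Basis (Fin 4) ℝ (Fin 4 → ℝ))
    (o : Fin 3 → Fin 4 → ℝ) (M : Fin 3 → Fin 4 → ℤ) : Prop where
  isFacetBasis : IsFacetBasis P b
  injective : o.Injective
  range_eq : Set.range o = vertices P \ Set.range b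
  repr_eq : ∀ k i, b.repr (o k) i = M k i

namespace IsCoordinates

variable {P : Set (Fin 4 → ℝ)} {b : Basis (Fin 4) ℝ (Fin 4 → ℝ)} {o : Fin 3 → Fin 4 → ℝ}
  {M : Fin 3 → Fin 4 → ℤ}

theorem eq_sum (h : IsCoordinates P b o M) (k : Fin 3) : o k = ∑ i, (M k i : ℝ) • b i := by
  rw [← b.sum_repr (o k)]
  simp [h.repr_eq]

theorem facetForm_eq_height (h : IsCoordinates P b o M) (k : Fin 3) :
    facetForm b (o k) = height M k := by
  simp [facetForm_apply, h.repr_eq, height, Fin.sum_univ_four]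

theorem mem (h : IsCoordinates P b o M) (k : Fin 3) : o k ∈ vertices P \ Set.range b :=
  h.range_eq ▸ Set.mem_range_self k

theorem height_nonpos (h : IsCoordinates P b o M) (k : Fin 3) : height M k ≤ 0 := by
  have := h.isFacetBasis.lt_one (h.mem k).1 (h.mem k).2
  rw [h.facetForm_eq_height] at this
  exact Int.lt_add_one_iff.1 (by exact_mod_cast this)

/-- The origin is strictly between positive multiples of `b 0` and `-b 0` in `P`, so it is not a
vertex. -/
theorem row_ne_zero (hP : IsCentered P) (h : IsCoordinates P b o M) (k : Fin 3) : M k ≠ 0 := by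
  intro h0
  have ho : o k = 0 := by rw [h.eq_sum]; simp [h0]
  have hv := (h.mem k).1
  rw [ho] at hv
  obtain ⟨t, ht, hmem⟩ := hP.exists_smul_mem (b 0)
  obtain ⟨s, hs, hmem'⟩ := hP.exists_smul_mem (-b 0)
  have := hv.2 hmem hmem' ⟨s / (s + t), t / (s + t), by positivity, by positivity,
    by field_simp, by
      rw [smul_neg, smul_neg, smul_smul, smul_smul, ← sub_eq_add_neg, ← sub_smul]
      rw [show s / (s + t) * t - t / (s + t) * s = 0 by ring, zero_smul]⟩
  exact b.ne_zero 0 ((smul_eq_zero.1 this).resolve_left ht.ne')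

/-- Crossing a ridge gives coordinates of the same kind, so the argument can be repeated at the
adjacent facet. -/
theorem exists_pivot (hP : IsFanoPolyhedron P) (h : IsCoordinates P b o M) (i : Fin 4) :
    ∃ k, isNeighbor M i k = true ∧ ∃ b' o', IsCoordinates P b' o' (pivot M i k) := by
  obtain ⟨n, hn, hnb, hni, hlt, b', hb', hfb, -⟩ :=
    hP.exists_neighbor (by norm_num) h.isFacetBasis i
  obtain ⟨k, rfl⟩ : n ∈ Set.range o := h.range_eq ▸ ⟨hn, hnb⟩
  have hki : M k i = -1 := by
    rw [h.repr_eq] at hni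
    exact_mod_cast hni
  refine ⟨k, isNeighbor_iff.2 ⟨hki, fun z hz => ?_⟩, b', Function.update o k (b i), hfb, ?_, ?_, ?_⟩
  · have := hlt (o z) (h.mem z).1 (h.mem z).2 (h.injective.ne hz)
    rw [h.facetForm_eq_height, h.facetForm_eq_height, h.repr_eq] at this
    exact_mod_cast this
  · intro x y hxy
    by_contra hne
    have hz : ∀ z, z ≠ k → b i ≠ o z := fun z _ hz => (h.mem z).2 ⟨i, hz⟩
    rcases eq_or_ne x k with rfl | hx
    · rw [Function.update_self, Function.update_of_ne (Ne.symm hne)] at hxy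
      exact hz y (Ne.symm hne) hxy
    · rcases eq_or_ne y k with rfl | hy
      · rw [Function.update_self, Function.update_of_ne hx] at hxy
        exact hz x hx hxy.symm
      · rw [Function.update_of_ne hx, Function.update_of_ne hy] at hxy
        exact hne (h.injective hxy)
  · rw [hb']
    ext x
    constructor
    · rintro ⟨z, rfl⟩
      rcases eq_or_ne z k with rfl | hz
      · rw [Function.update_self]
        refine ⟨h.isFacetBasis.mem_vertices i, ?_⟩
        rintro ⟨j, hj⟩
        rcases eq_or_ne j i with rfl | hji
        · rw [Function.update_self] at hj
          exact hnb ⟨j, hj.symm⟩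
        · rw [Function.update_of_ne hji] at hj
          exact hji (b.injective hj)
      · rw [Function.update_of_ne hz]
        refine ⟨(h.mem z).1, ?_⟩
        rintro ⟨j, hj⟩
        rcases eq_or_ne j i with rfl | hji
        · rw [Function.update_self] at hj
          exact hz (h.injective hj).symm
        · rw [Function.update_of_ne hji] at hj
          exact (h.mem z).2 ⟨j, hj⟩
    · rintro ⟨hx, hxb⟩
      by_cases hxr : x ∈ Set.range b
      · obtain ⟨j, rfl⟩ := hxr
        have hji : j = i := by
          by_contra hji
          exact hxb ⟨j, Function.update_of_ne hji _ _⟩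
        exact ⟨k, by rw [hji, Function.update_self]⟩
      · obtain ⟨z, rfl⟩ : x ∈ Set.range o := h.range_eq ▸ ⟨hx, hxr⟩
        refine ⟨z, Function.update_of_ne ?_ _ _⟩
        rintro rfl
        exact hxb ⟨i, Function.update_self _ _ _⟩
  · have hsum : ∀ z, Function.update o k (b i) z = ∑ j, (pivot M i k z j : ℝ) • b' j := by
      intro z
      have hk := h.eq_sum k
      have hrest : ∀ f : Fin 4 → ℝ, ∑ j, f j • b' j =
          f i • o k + ∑ j ∈ Finset.univ.erase i, f j • b j := by
        intro f
        rw [← Finset.add_sum_erase _ _ (Finset.mem_univ i), hb', Function.update_self]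
        congr 1
        refine Finset.sum_congr rfl fun j hj => ?_
        rw [Function.update_of_ne (Finset.ne_of_mem_erase hj)]
      -- As the `i`-th coordinate of `o k` is -1, this expresses `b i` through the new basis and
      -- yields the formula for `pivot`.
      have hk' : ∑ j ∈ Finset.univ.erase i, (M k j : ℝ) • b j = o k + b i := by
        rw [hk, ← Finset.add_sum_erase _ _ (Finset.mem_univ i), hki]
        push_cast
        module
      rw [hrest]
      rcases eq_or_ne z k with rfl | hz
      · have : ∑ j ∈ Finset.univ.erase i, (pivot M i z z j : ℝ) • b j =
            ∑ j ∈ Finset.univ.erase i, (M z j : ℝ) • b j :=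
          Finset.sum_congr rfl fun j hj => by simp [pivot, Finset.ne_of_mem_erase hj]
        rw [this, hk', Function.update_self]
        simp [pivot]
      · have : ∑ j ∈ Finset.univ.erase i, (pivot M i k z j : ℝ) • b j =
            ∑ j ∈ Finset.univ.erase i, (M z j : ℝ) • b j +
              (M z i : ℝ) • ∑ j ∈ Finset.univ.erase i, (M k j : ℝ) • b j := by
          rw [Finset.smul_sum, ← Finset.sum_add_distrib]
          refine Finset.sum_congr rfl fun j hj => ?_
          simp [pivot, Finset.ne_of_mem_erase hj, hz, add_smul, mul_smul]
        rw [this, hk', Function.update_of_ne hz, h.eq_sum z,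
          ← Finset.add_sum_erase _ _ (Finset.mem_univ i)]
        simp only [pivot, hz, if_false, if_true]
        push_cast
        module
    intro z j
    rw [hsum z]
    simp [Finsupp.single_apply]

theorem hasNeighbors (hP : IsFanoPolyhedron P) (n : ℕ) (h : IsCoordinates P b o M) :
    hasNeighbors n M = true := by
  induction n generalizing b o M with
  | zero => rfl
  | succ n ih =>
    refine hasNeighbors_succ.2 fun i => ?_
    obtain ⟨k, hk, b', o', h'⟩ := h.exists_pivot hP i
    exact ⟨k, hk, ih h'⟩

end IsCoordinates

theorem IsFacetBasis.reindex {d : ℕ} {P : Set (Fin d → ℝ)} {b : Basis (Fin d) ℝ (Fin d → ℝ)}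
    (hb : IsFacetBasis P b) (π : Equiv.Perm (Fin d)) : IsFacetBasis P (b.reindex π) := by
  have hf : facetForm (b.reindex π) = facetForm b :=
    facetForm_eq fun i => by rw [Basis.reindex_apply, facetForm_self]
  refine ⟨by simpa [hf] using hb.le_one, ?_, ?_⟩
  · rw [hf, hb.tight_eq, Basis.range_reindex]
  · rw [Basis.range_reindex, hb.span_eq]

theorem exists_coordinates (P : FanoPolyhedron 4 7) :
    ∃ b o M, IsCoordinates P.1 b o M ∧ (∀ k l, k ≤ l → height M l ≤ height M k) ∧
      (∀ i, -1 ≤ (column M i).total) ∧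
      ∀ i j, i ≤ j → (column M i).key ≤ (column M j).key := by
  have hP := P.2.1
  have hfin := hP.isCentered.finite_vertices
  obtain ⟨b, hb, hs⟩ := hP.exists_special_facet (by norm_num)
  have hcard : (vertices P.1 \ Set.range b).ncard = 3 := by
    rw [Set.ncard_sdiff (Set.range_subset_iff.2 hb.mem_vertices) (Set.finite_range b), P.2.2,
      Set.ncard_range_of_injective b.injective]
    simp
  have := (hfin.subset (Set.sdiff_subset (t := Set.range b))).to_subtype
  have e : Fin 3 ≃ ↑(vertices P.1 \ Set.range b) :=
    (Finite.equivFinOfCardEq (by rw [Nat.card_coe_set_eq, hcard])).symm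
  -- Sorting by the negated value puts the heights in decreasing order.
  let τ := Tuple.sort fun k => -facetForm b (e k)
  have hτ : Monotone ((fun k => -facetForm b (e k)) ∘ τ) := Tuple.monotone_sort _
  let o : Fin 3 → Fin 4 → ℝ := fun k => e (τ k)
  have ho : o.Injective := fun x y h => τ.injective (e.injective (Subtype.ext h))
  have hr : Set.range o = vertices P.1 \ Set.range b := by
    rw [← Subtype.range_coe (s := vertices P.1 \ Set.range b)]
    exact EquivLike.range_comp Subtype.val (τ.trans e)
  have hmem : ∀ k, o k ∈ vertices P.1 := fun k => (e (τ k)).2.1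
  choose M hM using fun k i => hb.exists_int (hP.integral _ (hmem k)) i
  have hC : IsCoordinates P.1 b o M := ⟨hb, ho, hr, hM⟩
  let π := Tuple.sort fun i => (column M i).key
  have hπ : Monotone ((fun i => (column M i).key) ∘ π) := Tuple.monotone_sort _
  have hheight : ∀ k, height (fun k i => M k (π i)) k = height M k := by
    intro k
    have := Equiv.sum_comp π (M k)
    rw [Fin.sum_univ_four, Fin.sum_univ_four] at this
    exact this
  refine ⟨b.reindex π.symm, o, fun k i => M k (π i), ⟨hb.reindex _, ho, ?_, ?_⟩, ?_, ?_, ?_⟩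
  · rw [Basis.range_reindex, hr]
  · intro k i
    simp [hM]
  · intro k l hkl
    have := hτ hkl
    simp only [Function.comp_apply, neg_le_neg_iff] at this
    rw [hheight, hheight]
    have h' : facetForm b (o l) ≤ facetForm b (o k) := this
    rw [hC.facetForm_eq_height, hC.facetForm_eq_height] at h'
    exact_mod_cast h'
  · intro i
    classical
    have hset : hfin.toFinset = Finset.univ.image b ∪ Finset.univ.image o := by
      ext x
      have hx : x ∈ Set.range o ↔ x ∈ vertices P.1 \ Set.range b := by rw [hr]
      simp only [Set.Finite.mem_toFinset, Finset.mem_union, Finset.mem_image, Finset.mem_univ,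
        true_and, ← Set.mem_range, hx, Set.mem_sdiff]
      constructor
      · intro h
        by_cases hxb : x ∈ Set.range b
        exacts [Or.inl hxb, Or.inr ⟨h, hxb⟩]
      · rintro (⟨j, rfl⟩ | h)
        exacts [hb.mem_vertices j, h.1]
    have hdisj : Disjoint (Finset.univ.image b) (Finset.univ.image o) := by
      rw [Finset.disjoint_left]
      intro x hx hx'
      simp only [Finset.mem_image, Finset.mem_univ, true_and] at hx hx'
      obtain ⟨j, rfl⟩ := hx
      obtain ⟨k, hk⟩ := hx'
      exact (e (τ k)).2.2 ⟨j, hk.symm⟩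
    -- The base vertices contribute exactly 1 to this coordinate of the sum of all vertices; hence
    -- the bound -1 for the column total.
    have hi := hs (π i)
    rw [hset, Finset.sum_union hdisj, Finset.sum_image b.injective.injOn,
      Finset.sum_image ho.injOn] at hi
    simp only [map_add, map_sum, Basis.repr_self, Finsupp.coe_add, Finsupp.coe_finsetSum,
      Pi.add_apply, Finset.sum_apply, hM, Fin.sum_univ_three] at hi
    simp only [Finsupp.single_apply, Finset.sum_ite_eq', Finset.mem_univ, if_true] at hi
    simp only [column, Triple.total]
    have : (-1 : ℝ) ≤ ((M 0 (π i) + M 1 (π i) + M 2 (π i) : ℤ) : ℝ) := by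
      push_cast
      linarith
    exact_mod_cast this
  · intro i j hij
    exact hπ hij

/-- The vertices of `P`, numbered suitably, satisfy the linear relations of the vectors of some
name. -/
theorem exists_numbering (P : FanoPolyhedron 4 7) :
    ∃ (a : Name) (v : Fin 7 ↪ (Fin 4 → ℝ)), IsNumbering P v ∧
      ∀ j, v j = ∑ i, (a.stdVec j i : ℝ) • v (a.type.base i) := by
  obtain ⟨b, o, M, hC, hmono, hs, hkey⟩ := exists_coordinates P
  obtain ⟨a, σ, hσ, hmatch⟩ := exists_matches_of_allMatch allMatch_candidates
    (mem_candidates hC.height_nonpos hmono hs hkey (hC.row_ne_zero P.2.1.isCentered)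
      (hC.hasNeighbors P.2.1 3))
  let u : Fin 7 → Fin 4 → ℝ := fun j => ∑ m, (frame M j m : ℝ) • b m
  have hu : ∀ j, u j = ![b 0, b 1, b 2, b 3, o 0, o 1, o 2] j := by
    intro j
    fin_cases j <;> simp [u, frame, Fin.sum_univ_four, hC.eq_sum]
  have hrange : Set.range u = vertices P.1 := by
    have h₁ : Set.range u = Set.range b ∪ Set.range o := by
      ext x
      simp [hu, Fin.exists_fin_succ, or_assoc, eq_comm]
    rw [h₁, hC.range_eq, Set.union_sdiff_cancel]
    exact Set.range_subset_iff.2 hC.isFacetBasis.mem_vertices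
  have hinj : u.Injective := by
    rw [← Set.injOn_univ]
    refine Set.injOn_of_ncard_image_eq ?_ Set.finite_univ
    rw [Set.image_univ, hrange, P.2.2, Set.ncard_univ, Nat.card_eq_fintype_card, Fintype.card_fin]
  refine ⟨a, ⟨u ∘ σ, hinj.comp hσ⟩, ?_, fun j => ?_⟩
  · have hσ' := Finite.surjective_of_injective hσ
    change Set.range (u ∘ σ) = _
    rw [hσ'.range_comp, hrange]
  · change u (σ j) = ∑ i, (a.stdVec j i : ℝ) • u (σ (a.type.base i))
    simp only [u, hmatch j, Finset.smul_sum]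
    rw [Finset.sum_comm]
    refine Finset.sum_congr rfl fun m _ => ?_
    push_cast
    rw [Finset.sum_smul]
    simp [mul_smul]

end FanoClassification

namespace FanoClassification

/-! ### Combinatorial and numerical data of the listed systems -/

/-- The vertex sets of the facets, in terms of the numbering. -/
def CombType.facets : CombType → List (Fin 4 → Fin 7)
  | .D => [![1, 2, 4, 6], ![1, 2, 4, 7], ![1, 2, 5, 6], ![1, 2, 5, 7], ![1, 3, 4, 6],
      ![1, 3, 4, 7], ![1, 3, 5, 6], ![1, 3, 5, 7], ![2, 3, 4, 6], ![2, 3, 4, 7],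
      ![2, 3, 5, 6], ![2, 3, 5, 7]]
  | .E => [![1, 3, 4, 5], ![1, 6, 3, 4], ![1, 3, 5, 6], ![1, 4, 5, 6], ![2, 3, 4, 6],
      ![2, 3, 4, 7], ![2, 3, 5, 6], ![2, 3, 5, 7], ![2, 4, 5, 6], ![2, 4, 5, 7],
      ![3, 4, 5, 7]]
  | .G => [![1, 2, 4, 5], ![1, 2, 4, 6], ![1, 2, 5, 6], ![1, 3, 4, 5], ![1, 3, 4, 6],
      ![1, 3, 5, 6], ![2, 3, 5, 6], ![2, 3, 5, 7], ![2, 3, 6, 7], ![2, 4, 5, 7],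
      ![2, 4, 6, 7], ![3, 4, 5, 7], ![3, 4, 6, 7]]

/-- The sets of indices that contain none of the primitive collections. -/
def CombType.Free (t : CombType) (S : Finset (Fin 7)) : Prop :=
  ∀ C ∈ t.collections, ¬ C ⊆ S

instance (t : CombType) (S : Finset (Fin 7)) : Decidable (t.Free S) :=
  List.decidableBAll _ _

/-- Coefficients of a positive linear relation between all vertices. -/
def Name.posCoeff : Name → Fin 7 → ℤ
  | .D i => posD i
  | .E i => posE i
  | .G i => posG i
where
  posD : Fin 19 → Fin 7 → ℤ :=
    ![![4, 1, 1, 1, 1, 1, 1], ![4, 1, 1, 1, 1, 3, 1], ![4, 1, 1, 1, 1, 2, 1],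
    ![5, 1, 2, 2, 1, 1, 1], ![1, 1, 1, 1, 1, 3, 1], ![3, 1, 1, 1, 1, 1, 1],
    ![1, 1, 3, 3, 1, 1, 1], ![3, 1, 1, 1, 1, 2, 1], ![2, 1, 1, 1, 1, 2, 1],
    ![3, 1, 2, 2, 1, 1, 1], ![1, 1, 3, 3, 1, 2, 1], ![1, 1, 1, 1, 1, 2, 1],
    ![1, 1, 1, 1, 1, 1, 1], ![1, 1, 2, 2, 1, 1, 1], ![1, 1, 1, 1, 1, 2, 1],
    ![2, 1, 1, 1, 1, 2, 1], ![1, 1, 1, 2, 1, 1, 1], ![1, 1, 1, 1, 1, 1, 2],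
    ![1, 1, 1, 1, 1, 1, 1]]
  posE : Fin 3 → Fin 7 → ℤ :=
    ![![6, 1, 1, 2, 2, 2, 1], ![4, 1, 1, 2, 2, 2, 1], ![2, 1, 1, 2, 2, 2, 1]]
  posG : Fin 6 → Fin 7 → ℤ :=
    ![![4, 1, 1, 1, 2, 1, 1], ![1, 1, 4, 4, 1, 2, 2], ![2, 1, 1, 1, 2, 1, 1],
    ![1, 2, 1, 3, 1, 2, 2], ![1, 2, 1, 1, 1, 2, 2], ![1, 1, 2, 2, 1, 2, 2]]

/-- The dual basis of the rows `a, b, c, e` of a unimodular matrix, from the determinant `D` and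
the `2 × 2` minors `s` of the first two and `t` of the last two rows. -/
def dualOfMinors (D a₀ a₁ a₂ a₃ b₀ b₁ b₂ b₃ c₀ c₁ c₂ c₃ e₀ e₁ e₂ e₃
    s₀ s₁ s₂ s₃ s₄ s₅ t₀ t₁ t₂ t₃ t₄ t₅ : ℤ) : Fin 4 → Fin 4 → ℤ :=
  ![![D * (b₁ * t₅ - b₂ * t₄ + b₃ * t₃), D * (-b₀ * t₅ + b₂ * t₂ - b₃ * t₁),
      D * (b₀ * t₄ - b₁ * t₂ + b₃ * t₀), D * (-b₀ * t₃ + b₁ * t₁ - b₂ * t₀)],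
    ![D * (-a₁ * t₅ + a₂ * t₄ - a₃ * t₃), D * (a₀ * t₅ - a₂ * t₂ + a₃ * t₁),
      D * (-a₀ * t₄ + a₁ * t₂ - a₃ * t₀), D * (a₀ * t₃ - a₁ * t₁ + a₂ * t₀)],
    ![D * (e₁ * s₅ - e₂ * s₄ + e₃ * s₃), D * (-e₀ * s₅ + e₂ * s₂ - e₃ * s₁),
      D * (e₀ * s₄ - e₁ * s₂ + e₃ * s₀), D * (-e₀ * s₃ + e₁ * s₁ - e₂ * s₀)],
    ![D * (-c₁ * s₅ + c₂ * s₄ - c₃ * s₃), D * (c₀ * s₅ - c₂ * s₂ + c₃ * s₁),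
      D * (-c₀ * s₄ + c₁ * s₂ - c₃ * s₀), D * (c₀ * s₃ - c₁ * s₁ + c₂ * s₀)]]

/-- The dual basis of the rows `a, b, c, e` of a unimodular matrix, from the minors. -/
def dualOfRows (a₀ a₁ a₂ a₃ b₀ b₁ b₂ b₃ c₀ c₁ c₂ c₃ e₀ e₁ e₂ e₃
    s₀ s₁ s₂ s₃ s₄ s₅ t₀ t₁ t₂ t₃ t₄ t₅ : ℤ) : Fin 4 → Fin 4 → ℤ :=
  dualOfMinors (s₀ * t₅ - s₁ * t₄ + s₂ * t₃ + s₃ * t₂ - s₄ * t₁ + s₅ * t₀)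
    a₀ a₁ a₂ a₃ b₀ b₁ b₂ b₃ c₀ c₁ c₂ c₃ e₀ e₁ e₂ e₃ s₀ s₁ s₂ s₃ s₄ s₅ t₀ t₁ t₂ t₃ t₄ t₅

/-- The dual basis of the rows of a unimodular matrix. -/
def dualRows (a b c e : Fin 4 → ℤ) : Fin 4 → Fin 4 → ℤ :=
  dualOfRows (a 0) (a 1) (a 2) (a 3) (b 0) (b 1) (b 2) (b 3) (c 0) (c 1) (c 2) (c 3)
    (e 0) (e 1) (e 2) (e 3)
    (a 0 * b 1 - a 1 * b 0) (a 0 * b 2 - a 2 * b 0) (a 0 * b 3 - a 3 * b 0)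
    (a 1 * b 2 - a 2 * b 1) (a 1 * b 3 - a 3 * b 1) (a 2 * b 3 - a 3 * b 2)
    (c 0 * e 1 - c 1 * e 0) (c 0 * e 2 - c 2 * e 0) (c 0 * e 3 - c 3 * e 0)
    (c 1 * e 2 - c 2 * e 1) (c 1 * e 3 - c 3 * e 1) (c 2 * e 3 - c 3 * e 2)

/-- The pairing of integer vectors. -/
def pair (x y : Fin 4 → ℤ) : ℤ := x 0 * y 0 + x 1 * y 1 + x 2 * y 2 + x 3 * y 3

/-- The dual basis of the facet `f`. -/
def Name.dual (a : Name) (f : Fin 4 → Fin 7) : Fin 4 → Fin 4 → ℤ :=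
  dualRows (a.stdVec (f 0)) (a.stdVec (f 1)) (a.stdVec (f 2)) (a.stdVec (f 3))

/-- Decide a property of all names. -/
theorem Name.of_decide {p : Name → Prop} [DecidablePred p]
    (hD : ∀ i, decide (p (.D i)) = true) (hE : ∀ i, decide (p (.E i)) = true)
    (hG : ∀ i, decide (p (.G i)) = true) (a : Name) : p a := by
  cases a with
  | D i => exact of_decide_eq_true (hD i)
  | E i => exact of_decide_eq_true (hE i)
  | G i => exact of_decide_eq_true (hG i)

namespace Name

set_option maxRecDepth 100000 in
theorem stdVec_base : ∀ a : Name, ∀ i m, a.stdVec (a.type.base i) m = if i = m then 1 else 0 :=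
  Name.of_decide (by decide +kernel) (by decide +kernel) (by decide +kernel)

set_option maxRecDepth 100000 in
theorem all_pair_dual : ∀ a : Name, a.type.facets.all (fun f => decide (∀ i j,
    pair (a.dual f i) (a.stdVec (f j)) = if i = j then 1 else 0)) = true :=
  Name.of_decide (by decide +kernel) (by decide +kernel) (by decide +kernel)

theorem pair_dual (a : Name) : ∀ f ∈ a.type.facets, ∀ i j,
    pair (a.dual f i) (a.stdVec (f j)) = if i = j then 1 else 0 := by
  simpa only [List.all_eq_true, decide_eq_true_eq] using all_pair_dual a

set_option maxRecDepth 100000 in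
theorem all_pair_nonpos : ∀ a : Name, a.type.facets.all (fun f => decide (∀ j, (∀ i, f i ≠ j) →
    pair (a.dual f 0) (a.stdVec j) + pair (a.dual f 1) (a.stdVec j) +
      pair (a.dual f 2) (a.stdVec j) + pair (a.dual f 3) (a.stdVec j) ≤ 0)) = true :=
  Name.of_decide (by decide +kernel) (by decide +kernel) (by decide +kernel)

theorem pair_nonpos (a : Name) : ∀ f ∈ a.type.facets, ∀ j, (∀ i, f i ≠ j) →
    pair (a.dual f 0) (a.stdVec j) + pair (a.dual f 1) (a.stdVec j) +
      pair (a.dual f 2) (a.stdVec j) + pair (a.dual f 3) (a.stdVec j) ≤ 0 := by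
  simpa only [List.all_eq_true, decide_eq_true_eq] using all_pair_nonpos a

-- Together with `sum_posCoeff`, this places the origin in the interior of the convex hull.
set_option maxRecDepth 100000 in
theorem posCoeff_pos : ∀ a : Name, ∀ j, 0 < a.posCoeff j :=
  Name.of_decide (by decide +kernel) (by decide +kernel) (by decide +kernel)

set_option maxRecDepth 100000 in
theorem sum_posCoeff : ∀ a : Name, ∀ m, ∑ j, a.posCoeff j * a.stdVec j m = 0 :=
  Name.of_decide (by decide +kernel) (by decide +kernel) (by decide +kernel)

set_option maxRecDepth 100000 in
theorem relation : ∀ a : Name, ∀ r ∈ a.relations, ∀ m,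
    ∑ j ∈ r.1, a.stdVec j m = (r.2.map fun j => a.stdVec j m).sum :=
  Name.of_decide (by decide +kernel) (by decide +kernel) (by decide +kernel)

-- This numerical form of the Fano condition prevents a proper face from containing a primitive
-- collection.
set_option maxRecDepth 100000 in
theorem card_lt : ∀ a : Name, ∀ r ∈ a.relations, r.2.card < r.1.card :=
  Name.of_decide (by decide +kernel) (by decide +kernel) (by decide +kernel)

set_option maxRecDepth 100000 in
theorem free_right : ∀ a : Name, ∀ r ∈ a.relations, a.type.Free r.2.toFinset :=
  Name.of_decide (by decide +kernel) (by decide +kernel) (by decide +kernel)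

end Name

theorem CombType.exists_facet {t : CombType} {S : Finset (Fin 7)} (h : t.Free S) :
    ∃ f ∈ t.facets, ∀ j ∈ S, ∃ i, f i = j := by
  have : ∀ S, t.Free S → t.facets.any (fun f => decide (∀ j ∈ S, ∃ i, f i = j)) = true := by
    cases t <;> decide +kernel
  simpa only [List.any_eq_true, decide_eq_true_eq] using this S h

theorem CombType.free_singleton (t : CombType) (j : Fin 7) : t.Free {j} := by
  cases t <;> revert j <;> decide +kernel

/-- The primitive collections are the minimal sets that are not free. -/
theorem CombType.mem_collections_iff (t : CombType) (S : Finset (Fin 7)) :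
    S ∈ t.collections ↔ ¬ t.Free S ∧ ∀ T, T ⊂ S → t.Free T := by
  have key : t.collections.all fun C => t.collections.all fun D => decide (D ⊆ C → D = C) := by
    cases t <;> decide +kernel
  simp only [List.all_eq_true, decide_eq_true_eq] at key
  constructor
  · intro hS
    refine ⟨fun h => h S hS subset_rfl, fun T hT C hC hCT => ?_⟩
    have := key S hS C hC (hCT.trans hT.subset)
    subst this
    exact hT.2 hCT
  · rintro ⟨hS, hmin⟩
    simp only [CombType.Free, not_forall, not_not] at hS
    obtain ⟨C, hC, hCS⟩ := hS
    rcases hCS.eq_or_ssubset with rfl | h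
    exacts [hC, absurd subset_rfl (hmin C h C hC)]

theorem Name.exists_relation_iff (a : Name) (S : Finset (Fin 7)) :
    (∃ r ∈ a.relations, r.1 = S) ↔ S ∈ a.type.collections := by
  cases a <;> simp [Name.relations, Name.type, CombType.collections, eq_comm]

end FanoClassification

/-! ### The polytopes of the listed vectors and their faces -/

namespace FanoClassification

open Module

namespace Name

variable (a : Name) (b : Basis (Fin 4) ℝ (Fin 4 → ℝ))

/-- The vectors of a name in the coordinates given by a basis. -/
noncomputable def vec (j : Fin 7) : Fin 4 → ℝ := ∑ i, (a.stdVec j i : ℝ) • b i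

/-- The polytope of a name in the coordinates given by a basis. -/
noncomputable def hull : Set (Fin 4 → ℝ) := convexHull ℝ (Set.range (a.vec b))

/-- The functional with given integral coefficients. -/
noncomputable def intForm (u : Fin 4 → ℤ) : (Fin 4 → ℝ) →ₗ[ℝ] ℝ := ∑ i, (u i : ℝ) • b.coord i

theorem repr_vec (j : Fin 7) (i : Fin 4) : b.repr (a.vec b j) i = a.stdVec j i := by
  simp [vec, Finsupp.single_apply]

theorem vec_base (i : Fin 4) : a.vec b (a.type.base i) = b i := by
  simp [vec, a.stdVec_base]

theorem intForm_vec (u : Fin 4 → ℤ) (j : Fin 7) :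
    intForm b u (a.vec b j) = (pair u (a.stdVec j) : ℤ) := by
  simp [intForm, repr_vec, pair, Fin.sum_univ_four]

theorem sum_vec_eq {r : Finset (Fin 7) × Multiset (Fin 7)} (hr : r ∈ a.relations) :
    ∑ j ∈ r.1, a.vec b j = (r.2.map (a.vec b)).sum := by
  refine b.ext_elem fun m => ?_
  have h : ((∑ j ∈ r.1, a.stdVec j m : ℤ) : ℝ) = ((r.2.map fun j => a.stdVec j m).sum : ℤ) := by
    rw [a.relation r hr m]
  change b.coord m _ = b.coord m _
  rw [map_sum, map_multiset_sum, Multiset.map_map]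
  simp only [Function.comp_def, Basis.coord_apply, repr_vec]
  rw [Int.cast_sum] at h
  rw [h]
  exact (map_multiset_sum (Int.castAddHom ℝ) _).trans (by rw [Multiset.map_map]; rfl)

theorem dual_vec {f : Fin 4 → Fin 7} (hf : f ∈ a.type.facets) (i j : Fin 4) :
    intForm b (a.dual f i) (a.vec b (f j)) = if i = j then 1 else 0 := by
  rw [intForm_vec, a.pair_dual f hf]
  split_ifs <;> simp

/-- Take a facet containing `S`. Its functional `p` is 1 on the facet and at most 0 at the other
vertices. Subtracting a small multiple of the dual coordinates of the facet vertices outside `S`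
lowers those below 1, and the multiple is too small to raise any other vertex to 1. -/
theorem exists_functional {S : Finset (Fin 7)} (hS : a.type.Free S) :
    ∃ l : (Fin 4 → ℝ) →ₗ[ℝ] ℝ, (∀ j ∈ S, l (a.vec b j) = 1) ∧ ∀ j ∉ S, l (a.vec b j) < 1 := by
  obtain ⟨f, hf, hfS⟩ := CombType.exists_facet hS
  set p : (Fin 4 → ℝ) →ₗ[ℝ] ℝ := ∑ i, intForm b (a.dual f i) with hp
  set g : (Fin 4 → ℝ) →ₗ[ℝ] ℝ := ∑ i with f i ∉ S, intForm b (a.dual f i) with hg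
  have hpf : ∀ i, p (a.vec b (f i)) = 1 := fun i => by
    simp [hp, LinearMap.sum_apply, a.dual_vec b hf]
  have hgf : ∀ i, g (a.vec b (f i)) = if f i ∉ S then 1 else 0 := fun i => by
    simp [hg, LinearMap.sum_apply, a.dual_vec b hf]
  have hpn : ∀ j, (∀ i, f i ≠ j) → p (a.vec b j) ≤ 0 := fun j hj => by
    have := a.pair_nonpos f hf j hj
    simp only [hp, Fin.sum_univ_four, LinearMap.add_apply, intForm_vec]
    exact_mod_cast this
  set K : ℝ := 1 + ∑ j, |g (a.vec b j)| with hK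
  have hKpos : 0 < K := by positivity
  have hgK : ∀ j, |g (a.vec b j)| < K := fun j => by
    have : |g (a.vec b j)| ≤ ∑ j, |g (a.vec b j)| :=
      Finset.single_le_sum (f := fun j => |g (a.vec b j)|) (fun _ _ => abs_nonneg _)
        (Finset.mem_univ j)
    linarith
  refine ⟨p - K⁻¹ • g, fun j hj => ?_, fun j hj => ?_⟩
  · obtain ⟨i, rfl⟩ := hfS j hj
    simp [hpf, hgf, hj]
  · by_cases h : ∃ i, f i = j
    · obtain ⟨i, rfl⟩ := h
      simp [hpf, hgf, hj, hKpos]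
    · push Not at h
      have h₁ := hpn j h
      have h₂ : -1 < K⁻¹ * g (a.vec b j) := by
        rw [lt_inv_mul_iff₀ hKpos]
        linarith [neg_abs_le (g (a.vec b j)), hgK j]
      simp only [LinearMap.sub_apply, LinearMap.smul_apply, smul_eq_mul]
      linarith

theorem vec_injective : Function.Injective (a.vec b) := by
  intro i j hij
  obtain ⟨l, h₁, h₂⟩ := a.exists_functional b (a.type.free_singleton i)
  by_contra hne
  have h₃ := h₁ i (by simp)
  have h₄ := h₂ j (by simpa using Ne.symm hne)
  rw [hij] at h₃
  linarith

theorem linearIndependent_facet {f : Fin 4 → Fin 7} (hf : f ∈ a.type.facets) :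
    LinearIndependent ℝ fun i => a.vec b (f i) := by
  rw [Fintype.linearIndependent_iff]
  intro c hc i
  have := congrArg (intForm b (a.dual f i)) hc
  simpa [a.dual_vec b hf] using this

theorem linearIndependent_of_free {S : Finset (Fin 7)} (hS : a.type.Free S) :
    LinearIndependent ℝ fun j : S => a.vec b j := by
  obtain ⟨f, hf, hfS⟩ := CombType.exists_facet hS
  choose g hg using hfS
  have h := (a.linearIndependent_facet b hf).comp (fun j : S => g j j.2) fun x y hxy => by
    have : f (g x x.2) = f (g y y.2) := congrArg f hxy
    rw [hg, hg] at this
    exact Subtype.ext this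
  convert h using 2 with j
  simp [hg]

theorem vec_mem_hull (j : Fin 7) : a.vec b j ∈ a.hull b := subset_convexHull ℝ _ ⟨j, rfl⟩

theorem isCentered_hull : IsCentered (a.hull b) := by
  refine ⟨⟨_, Set.finite_range _, rfl⟩, ?_⟩
  have hconv : Convex ℝ (a.hull b) := convex_convexHull ℝ _
  have hpos : ∀ j, (0 : ℝ) < a.posCoeff j := fun j => by exact_mod_cast a.posCoeff_pos j
  have hzero : ∑ j, (a.posCoeff j : ℝ) • a.vec b j = 0 := by
    refine b.ext_elem fun m => ?_
    have := a.sum_posCoeff m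
    simp only [map_sum, map_smul, Finsupp.coe_finsetSum, Finset.sum_apply, Finsupp.smul_apply,
      repr_vec, smul_eq_mul, map_zero, Finsupp.coe_zero, Pi.zero_apply]
    exact_mod_cast this
  set C : ℝ := ∑ j, (a.posCoeff j : ℝ) with hC
  have hCpos : 0 < C := Finset.sum_pos (fun j _ => hpos j) Finset.univ_nonempty
  have hmem : ∀ w : Fin 7 → ℝ, (∀ j, 0 < w j) → ∑ j, w j • a.vec b j ∈
      (fun x => (∑ j, w j) • x) '' a.hull b := by
    intro w hw
    have hs : 0 < ∑ j, w j := Finset.sum_pos (fun j _ => hw j) Finset.univ_nonempty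
    refine ⟨∑ j, (w j / ∑ j, w j) • a.vec b j, hconv.sum_mem (fun j _ => (div_pos (hw j) hs).le) ?_
      (fun j _ => a.vec_mem_hull b j), ?_⟩
    · rw [← Finset.sum_div, div_self hs.ne']
    · simp only [Finset.smul_sum, smul_smul, mul_div_cancel₀ _ hs.ne']
  have h0 : (0 : Fin 4 → ℝ) ∈ a.hull b := by
    obtain ⟨x, hx, hx'⟩ := hmem _ hpos
    rw [hzero] at hx'
    rwa [← (smul_eq_zero.1 hx').resolve_left hCpos.ne']
  -- A surjective linear map is open, so positive weights with total below 1 have an open image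
  -- inside the hull. The rescaled positive relation maps to 0.
  let T : (Fin 7 → ℝ) →ₗ[ℝ] (Fin 4 → ℝ) := Fintype.linearCombination ℝ (a.vec b)
  have hT : Function.Surjective T := by
    rw [← LinearMap.range_eq_top, Fintype.range_linearCombination, eq_top_iff, ← b.span_eq]
    refine Submodule.span_mono ?_
    rintro _ ⟨i, rfl⟩
    exact ⟨_, a.vec_base b i⟩
  have hU : IsOpen {w : Fin 7 → ℝ | (∀ j, 0 < w j) ∧ ∑ j, w j < 1} := by
    have h₁ : IsOpen {w : Fin 7 → ℝ | ∀ j, 0 < w j} := by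
      simp only [Set.ofPred_forall]
      exact isOpen_iInter_of_finite fun j => isOpen_lt continuous_const (continuous_apply j)
    exact h₁.inter (isOpen_lt (f := fun w : Fin 7 → ℝ => ∑ j, w j) (by fun_prop) continuous_const)
  refine mem_interior.2 ⟨_, ?_, T.isOpenMap_of_finiteDimensional hT _ hU, ?_⟩
  · rintro _ ⟨w, ⟨hw, hw1⟩, rfl⟩
    obtain ⟨x, hx, hx'⟩ := hmem w hw
    simp only [T, Fintype.linearCombination_apply]
    rw [← hx']
    exact hconv.smul_mem_of_zero_mem h0 hx ⟨Finset.sum_nonneg fun j _ => (hw j).le, hw1.le⟩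
  · refine ⟨fun j => (2 * C)⁻¹ * a.posCoeff j, ⟨fun j => mul_pos (by positivity) (hpos j), ?_⟩, ?_⟩
    · rw [← Finset.mul_sum, ← hC, mul_inv]
      rw [mul_assoc, inv_mul_cancel₀ hCpos.ne']
      norm_num
    · simp only [T, Fintype.linearCombination_apply, mul_smul, ← Finset.smul_sum, hzero, smul_zero]

theorem le_one_of_vec {l : (Fin 4 → ℝ) →ₗ[ℝ] ℝ} (hl : ∀ j, l (a.vec b j) ≤ 1) :
    ∀ x ∈ a.hull b, l x ≤ 1 := fun _ hx =>
  convexHull_min (t := {x | l x ≤ 1}) (Set.range_subset_iff.2 hl)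
    (convex_halfSpace_le l.isLinear 1) hx

theorem vertices_hull : vertices (a.hull b) = Set.range (a.vec b) := by
  refine subset_antisymm extremePoints_convexHull_subset ?_
  rintro _ ⟨j, rfl⟩
  obtain ⟨l, h₁, h₂⟩ := a.exists_functional b (a.type.free_singleton j)
  have hle : ∀ x ∈ a.hull b, l x ≤ 1 := a.le_one_of_vec b fun k => by
    by_cases hk : k ∈ ({j} : Finset (Fin 7))
    exacts [(h₁ k hk).le, (h₂ k hk).le]
  have hF := IsCentered.isExposed_of_le_one hle
  have hne : (vertices {x ∈ a.hull b | l x = 1}).Nonempty := by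
    rw [← convexHull_nonempty_iff (𝕜 := ℝ),
      (a.isCentered_hull b).convexHull_vertices_of_isExposed hF]
    exact ⟨_, a.vec_mem_hull b j, h₁ j (by simp)⟩
  obtain ⟨x, hx⟩ := hne
  rw [vertices_of_isExposed hF] at hx
  obtain ⟨k, rfl⟩ := extremePoints_convexHull_subset hx.2
  have hkj : k = j := by
    by_contra hkj
    have := h₂ k (by simpa using hkj)
    linarith [hx.1.2]
  exact hkj ▸ hx.2

/-- The numbering of the vertices. -/
noncomputable def vecEmb : Fin 7 ↪ (Fin 4 → ℝ) := ⟨a.vec b, a.vec_injective b⟩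

theorem exists_face {S : Finset (Fin 7)} (hS : a.type.Free S) :
    ∃ F, IsProperFace (a.hull b) F ∧ vertices F = a.vec b '' S := by
  obtain ⟨l, h₁, h₂⟩ := a.exists_functional b hS
  have hle : ∀ x ∈ a.hull b, l x ≤ 1 := a.le_one_of_vec b fun k => by
    by_cases hk : k ∈ S
    exacts [(h₁ k hk).le, (h₂ k hk).le]
  refine ⟨_, (a.isCentered_hull b).isProperFace_of_le_one hle, ?_⟩
  rw [vertices_of_isExposed (IsCentered.isExposed_of_le_one hle), vertices_hull]
  ext x
  constructor
  · rintro ⟨hx, j, rfl⟩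
    refine ⟨j, ?_, rfl⟩
    by_contra hj
    linarith [h₂ j hj, hx.2]
  · rintro ⟨j, hj, rfl⟩
    exact ⟨⟨a.vec_mem_hull b j, h₁ j hj⟩, j, rfl⟩

theorem _root_.FanoClassification.CombType.Free.mono {t : CombType} {S T : Finset (Fin 7)}
    (hT : t.Free T) (h : S ⊆ T) : t.Free S := fun C hC hCS => hT C hC (hCS.trans h)

/-- If a face contained a primitive collection, its functional would equal the number of left terms
at the common sum, yet be at most the smaller number of right terms. -/
theorem exists_free_of_isProperFace {F : Set (Fin 4 → ℝ)} (hF : IsProperFace (a.hull b) F) :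
    ∃ S : Finset (Fin 7), a.type.Free S ∧ vertices F = a.vec b '' S := by
  classical
  obtain ⟨T, hT⟩ : ∃ T : Finset (Fin 7), ∀ j, j ∈ T ↔ a.vec b j ∈ F :=
    ⟨Finset.univ.filter fun j => a.vec b j ∈ F, by simp⟩
  refine ⟨T, ?_, ?_⟩
  · rcases F.eq_empty_or_nonempty with rfl | hne
    -- For the empty face the index set is empty, hence contained in a free singleton.
    · exact (a.type.free_singleton 0).mono fun j hj => absurd ((hT j).1 hj) (Set.notMem_empty _)
    · obtain ⟨l, hl, rfl⟩ := (a.isCentered_hull b).exists_functional_of_isProperFace hF hne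
      intro C hC hCF
      obtain ⟨r, hr, rfl⟩ := (a.exists_relation_iff C).2 hC
      have hsum := congrArg l (a.sum_vec_eq b hr)
      rw [map_sum, Finset.sum_congr rfl fun j hj => ((hT j).1 (hCF hj)).2,
        map_multiset_sum, Multiset.map_map] at hsum
      have hle := Multiset.sum_le_card_nsmul (r.2.map (l ∘ a.vec b)) 1 (by
        intro x hx
        obtain ⟨j, -, rfl⟩ := Multiset.mem_map.1 hx
        exact hl _ (a.vec_mem_hull b j))
      rw [← hsum] at hle
      have hlt := a.card_lt r hr
      simp only [Finset.sum_const, nsmul_eq_mul, mul_one, Multiset.card_map, Nat.cast_le] at hle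
      omega
  · rw [vertices_of_isExposed hF.1, vertices_hull]
    ext x
    constructor
    · rintro ⟨hx, j, rfl⟩
      exact ⟨j, (hT j).2 hx, rfl⟩
    · rintro ⟨j, hj, rfl⟩
      exact ⟨(hT j).1 hj, j, rfl⟩

theorem affineIndependent_of_free {S : Finset (Fin 7)} (hS : a.type.Free S) :
    AffineIndependent ℝ fun j : S => a.vec b j :=
  (a.linearIndependent_of_free b hS).affineIndependent

theorem finrank_vectorSpan_face {F : Set (Fin 4 → ℝ)} (hF : IsExposed ℝ (a.hull b) F)
    {S : Finset (Fin 7)} (hS : a.type.Free S) (hFS : vertices F = a.vec b '' S)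
    (hne : S.Nonempty) : finrank ℝ (vectorSpan ℝ F) + 1 = S.card := by
  obtain ⟨n, hn⟩ : ∃ n, S.card = n + 1 := ⟨S.card - 1, by have := hne.card_pos; omega⟩
  have h := (a.affineIndependent_of_free b hS).finrank_vectorSpan (n := n) (by simpa using hn)
  have hr : Set.range (fun j : S => a.vec b j) = vertices F := by
    rw [hFS, Set.image_eq_range]
    rfl
  rw [hr, ← direction_affineSpan, ← affineSpan_convexHull,
    (a.isCentered_hull b).convexHull_vertices_of_isExposed hF, direction_affineSpan] at h
  rw [h, hn]

end Name

end FanoClassification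

/-! ### Fans, primitive relations and simplex faces of the models -/

namespace FanoClassification

open Module

/-- A functional that is nonnegative on `W` is nonnegative on the cone spanned by `W`. -/
theorem nonneg_of_mem_hull {d : ℕ} {W : Set (Fin d → ℝ)} {g : (Fin d → ℝ) →ₗ[ℝ] ℝ}
    (hg : ∀ x ∈ W, 0 ≤ g x) {x : Fin d → ℝ} (hx : x ∈ PointedCone.hull ℝ W) : 0 ≤ g x := by
  refine Submodule.span_induction (p := fun x _ => 0 ≤ g x) hg (by simp) ?_ ?_ hx
  · intro x y _ _ hx hy
    rw [map_add]
    exact add_nonneg hx hy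
  · intro c x _ hx
    have : g (c • x) = (c : ℝ) * g x := g.map_smul c.1 x
    rw [this]
    exact mul_nonneg c.2 hx

theorem subset_faceCone {d : ℕ} (F : Set (Fin d → ℝ)) : vertices F ⊆ faceCone F :=
  Submodule.subset_span

theorem coneDim_faceCone {d : ℕ} (F : Set (Fin d → ℝ)) :
    coneDim (faceCone F) = finrank ℝ (Submodule.span ℝ (vertices F)) := by
  suffices h : Submodule.span ℝ (faceCone F : Set (Fin d → ℝ)) = Submodule.span ℝ (vertices F) by
    rw [coneDim, h]
  refine le_antisymm (Submodule.span_le.2 fun x hx => ?_) (Submodule.span_mono (subset_faceCone F))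
  refine Submodule.span_induction (p := fun x _ => x ∈ Submodule.span ℝ (vertices F))
    (fun x hx => Submodule.subset_span hx) (Submodule.zero_mem _)
    (fun x y _ _ => Submodule.add_mem _) ?_ hx
  intro c x _ hx
  exact Submodule.smul_mem _ (c : ℝ) hx

theorem multiset_sum_mem_faceCone {d : ℕ} {F : Set (Fin d → ℝ)} {R : Multiset (Fin d → ℝ)}
    (h : ∀ x ∈ R, x ∈ vertices F) : R.sum ∈ faceCone F :=
  multiset_sum_mem _ fun x hx => subset_faceCone F (h x hx)

namespace Name

variable (a : Name) (b : Basis (Fin 4) ℝ (Fin 4 → ℝ))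

/-- A cone of the fan contains no vertices besides its generators: if `l` exposes the face and `p`
the single vertex `j`, then `l - p` is nonnegative on the cone, so `l` is 1 at `j`. -/
theorem exists_fan_iff (S : Finset (Fin 7)) :
    (∃ σ ∈ fan (a.hull b), a.vec b '' S ⊆ (σ : Set (Fin 4 → ℝ))) ↔ a.type.Free S := by
  constructor
  · rintro ⟨_, ⟨F, hF, rfl⟩, hS⟩
    obtain ⟨T, hT, hFT⟩ := a.exists_free_of_isProperFace b hF
    obtain ⟨l, hl₁, hl₂⟩ := a.exists_functional b hT
    refine hT.mono fun j hj => ?_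
    obtain ⟨p, hp₁, hp₂⟩ := a.exists_functional b (a.type.free_singleton j)
    have h : 0 ≤ (l - p) (a.vec b j) := by
      refine nonneg_of_mem_hull (W := vertices F) ?_ (hS ⟨j, hj, rfl⟩)
      rw [hFT]
      rintro _ ⟨k, hk, rfl⟩
      rw [LinearMap.sub_apply, hl₁ k hk, sub_nonneg]
      by_cases hkj : k ∈ ({j} : Finset (Fin 7))
      exacts [(hp₁ k hkj).le, (hp₂ k hkj).le]
    rw [LinearMap.sub_apply, hp₁ j (by simp)] at h
    by_contra hj'
    linarith [hl₂ j hj']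
  · intro hS
    obtain ⟨F, hF, hFS⟩ := a.exists_face b hS
    exact ⟨_, ⟨F, hF, rfl⟩, hFS ▸ subset_faceCone F⟩

theorem isPrimitiveCollection_iff (S : Finset (Fin 7)) :
    IsPrimitiveCollection (a.hull b) (S.map (a.vecEmb b)) ↔ S ∈ a.type.collections := by
  have hfan : ∀ T : Finset (Fin 7), (∃ σ ∈ fan (a.hull b),
      ((T.map (a.vecEmb b) : Finset (Fin 4 → ℝ)) : Set (Fin 4 → ℝ)) ⊆ σ) ↔ a.type.Free T :=
    fun T => by
      rw [← a.exists_fan_iff b T, Finset.coe_map]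
      rfl
  rw [a.type.mem_collections_iff, IsPrimitiveCollection, hfan]
  refine ⟨fun ⟨_, h, h'⟩ => ⟨h, fun T hT => (hfan T).1 (h' _ (Finset.map_ssubset_map.2 hT))⟩,
    fun ⟨h, h'⟩ => ⟨?_, h, fun B hB => ?_⟩⟩
  · rw [vertices_hull, Finset.coe_map]
    exact Set.image_subset_range _ _
  · obtain ⟨T, -, rfl⟩ := Finset.subset_map_iff.1 hB.subset
    exact (hfan T).2 (h' T (Finset.map_ssubset_map.1 hB))

theorem isPrimitiveRelation {r : Finset (Fin 7) × Multiset (Fin 7)} (hr : r ∈ a.relations) :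
    IsPrimitiveRelation (a.hull b) (r.1.map (a.vecEmb b)) (r.2.map (a.vec b)) := by
  refine ⟨(a.isPrimitiveCollection_iff b _).2 ((a.exists_relation_iff _).1 ⟨r, hr, rfl⟩), ?_⟩
  have hfree := a.free_right r hr
  obtain ⟨F, hF, hFS⟩ := a.exists_face b hfree
  have hsum : ∑ x ∈ r.1.map (a.vecEmb b), x = (r.2.map (a.vec b)).sum := by
    rw [Finset.sum_map]
    exact a.sum_vec_eq b hr
  rw [hsum]
  refine ⟨F, hF, multiset_sum_mem_faceCone fun x hx => ?_, ?_, ?_, rfl⟩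
  · obtain ⟨j, hj, rfl⟩ := Multiset.mem_map.1 hx
    rw [hFS]
    exact ⟨j, by simpa using hj, rfl⟩
  · rintro _ ⟨F', hF', rfl⟩ hmem
    obtain ⟨T, hT, hFT⟩ := a.exists_free_of_isProperFace b hF'
    obtain ⟨l, hl₁, hl₂⟩ := a.exists_functional b hT
    obtain ⟨p, hp₁, hp₂⟩ := a.exists_functional b hfree
    -- Here `p` is 1 on all right-hand terms, so every such term must also have `l`-value 1. Any
    -- cone containing the sum thus contains the generators of the chosen cone, which gives
    -- minimality of the dimension.
    have h : 0 ≤ (l - p) (r.2.map (a.vec b)).sum := by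
      refine nonneg_of_mem_hull (W := vertices F') ?_ hmem
      rw [hFT]
      rintro _ ⟨k, hk, rfl⟩
      rw [LinearMap.sub_apply, hl₁ k hk, sub_nonneg]
      by_cases hkj : k ∈ r.2.toFinset
      exacts [(hp₁ k hkj).le, (hp₂ k hkj).le]
    rw [LinearMap.sub_apply, map_multiset_sum, map_multiset_sum, Multiset.map_map,
      Multiset.map_map, sub_nonneg] at h
    have hsub : ∀ j ∈ r.2, j ∈ T := by
      by_contra! hcon
      obtain ⟨j, hj, hjT⟩ := hcon
      refine h.not_gt (Multiset.sum_lt_sum (fun k hk => ?_) ⟨j, hj, ?_⟩)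
      · simp only [Function.comp_apply, hp₁ k (by simpa using hk)]
        by_cases hkT : k ∈ T
        exacts [(hl₁ k hkT).le, (hl₂ k hkT).le]
      · simpa only [Function.comp_apply, hp₁ j (by simpa using hj)] using hl₂ j hjT
    rw [coneDim_faceCone, coneDim_faceCone, hFS, hFT]
    refine Submodule.finrank_mono (Submodule.span_mono (Set.image_mono fun j hj => ?_))
    exact hsub j (by simpa using hj)
  · rw [hFS]
    ext x
    simp

theorem isSimplexFace_iff (T : Finset (Fin 7)) :
    IsSimplexFace (a.hull b) (a.vec b '' T) ↔ T.Nonempty ∧ a.type.Free T := by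
  have hcard : (a.vec b '' T).ncard = T.card := by
    rw [Set.ncard_image_of_injective _ (a.vec_injective b), Set.ncard_coe_finset]
  have hinj : ∀ S : Finset (Fin 7), a.vec b '' S = a.vec b '' T → S = T := fun S h =>
    Finset.coe_injective ((a.vec_injective b).image_injective h)
  constructor
  · rintro ⟨F, k, ⟨hF, hne, hk⟩, hFT, hkT⟩
    rw [hcard] at hkT
    refine ⟨Finset.card_pos.1 (by omega), ?_⟩
    -- The whole polytope has 7 vertices and would need dimension 6.
    have hFP : F ≠ a.hull b := by
      rintro rfl
      have h7 : T.card = 7 := by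
        rw [← hcard, ← hFT, vertices_hull, ← Set.image_univ,
          Set.ncard_image_of_injective _ (a.vec_injective b)]
        simp
      have := Submodule.finrank_le (vectorSpan ℝ (a.hull b))
      simp at this
      omega
    obtain ⟨S, hS, hFS⟩ := a.exists_free_of_isProperFace b ⟨hF, hFP⟩
    rwa [← hinj S (hFS.symm.trans hFT)]
  · rintro ⟨hne, hT⟩
    obtain ⟨F, hF, hFT⟩ := a.exists_face b hT
    refine ⟨F, _, ⟨hF.1, ?_, rfl⟩, hFT, ?_⟩
    · obtain ⟨j, hj⟩ := hne
      have : a.vec b j ∈ vertices F := hFT ▸ ⟨j, hj, rfl⟩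
      exact ⟨_, this.1⟩
    · rw [hcard, a.finrank_vectorSpan_face b hF.1 hT hFT hne]

variable {a b}

theorem isNumbering {P : FanoPolyhedron 4 7} (hP : P.1 = a.hull b) :
    IsNumbering P (a.vecEmb b) := by
  rw [IsNumbering, hP, vertices_hull]
  rfl

theorem describedBy {P : FanoPolyhedron 4 7} (hP : P.1 = a.hull b) : DescribedBy P a := by
  refine ⟨a.vecEmb b, isNumbering hP, fun S => ?_, fun r hr => ?_⟩
  · rw [hP, isPrimitiveCollection_iff, exists_relation_iff]
  · rw [hP]
    exact a.isPrimitiveRelation b hr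

end Name

theorem DescribedBy.hasType {P : FanoPolyhedron 4 7} {a : Name} (h : DescribedBy P a) :
    HasType P a.type := by
  obtain ⟨v, hv, h, -⟩ := h
  exact ⟨v, hv, fun S => (h S).trans (a.exists_relation_iff S)⟩

end FanoClassification

/-! ### The models are Fano, and every polyhedron is isomorphic to a model -/

namespace FanoClassification

open Module

namespace Name

variable (a : Name) (b : Basis (Fin 4) ℝ (Fin 4 → ℝ))

theorem intForm_basis (u : Fin 4 → ℤ) (m : Fin 4) : intForm b u (b m) = u m := by
  simp [intForm, LinearMap.sum_apply, Finsupp.single_apply]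

theorem basis_eq_sum {f : Fin 4 → Fin 7} (hf : f ∈ a.type.facets) (m : Fin 4) :
    b m = ∑ i, a.dual f i m • a.vec b (f i) := by
  have hli := a.linearIndependent_facet b hf
  let β : Basis (Fin 4) ℝ (Fin 4 → ℝ) := basisOfLinearIndependentOfCardEqFinrank hli (by simp)
  have hβ : ∀ i, β i = a.vec b (f i) := fun i => by simp [β]
  have hcoord : ∀ i, β.coord i = intForm b (a.dual f i) := fun i => by
    refine β.ext fun j => ?_
    rw [Basis.coord_apply, Basis.repr_self, hβ, a.dual_vec b hf, Finsupp.single_apply]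
    simp only [eq_comm]
  conv_lhs => rw [← β.sum_repr (b m)]
  refine Finset.sum_congr rfl fun i _ => ?_
  rw [← Basis.coord_apply, hcoord, intForm_basis, hβ, Int.cast_smul_eq_zsmul]

/-- With `basis_eq_sum`, whose coefficients are integral too, this shows that each facet spans the
same lattice as `b`. -/
theorem vec_mem_span (j : Fin 7) : a.vec b j ∈ Submodule.span ℤ (Set.range b) := by
  refine Submodule.sum_mem _ fun i _ => ?_
  rw [Int.cast_smul_eq_zsmul]
  exact Submodule.smul_mem _ _ (Submodule.subset_span ⟨i, rfl⟩)

theorem span_facet {f : Fin 4 → Fin 7} (hf : f ∈ a.type.facets) :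
    Submodule.span ℤ (Set.range fun i => a.vec b (f i)) = Submodule.span ℤ (Set.range b) := by
  refine le_antisymm (Submodule.span_le.2 ?_) (Submodule.span_le.2 ?_)
  · rintro _ ⟨i, rfl⟩
    exact a.vec_mem_span b _
  · rintro _ ⟨m, rfl⟩
    rw [a.basis_eq_sum b hf m]
    exact Submodule.sum_mem _ fun i _ => Submodule.smul_mem _ _ (Submodule.subset_span ⟨i, rfl⟩)

variable {b}

theorem isFanoPolyhedron_hull (hb : Submodule.span ℤ (Set.range b) = stdLattice 4) :
    IsFanoPolyhedron (a.hull b) where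
  polytope := (a.isCentered_hull b).polytope
  integral := by
    rw [vertices_hull]
    rintro _ ⟨j, rfl⟩
    exact hb ▸ a.vec_mem_span b j
  zero_mem := (a.isCentered_hull b).zero_mem
  simplicial := fun F hF => by
    obtain ⟨S, hS, hFS⟩ := a.exists_free_of_isProperFace b hF
    have h := (a.affineIndependent_of_free b hS).range
    have hr : (Set.range fun j : S => a.vec b j) = vertices F := by
      rw [hFS, Set.image_eq_range]
      rfl
    exact hr ▸ h
  unimodular := fun F k hk hF => by
    have hFP : F ≠ a.hull b := by
      rintro rfl
      have h : affineSpan ℝ (a.hull b) = ⊤ :=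
        (convex_convexHull ℝ _).interior_nonempty_iff_affineSpan_eq_top.1
          ⟨0, (a.isCentered_hull b).zero_mem⟩
      have := hF.2.2
      rw [← direction_affineSpan, h, AffineSubspace.direction_top, finrank_top] at this
      simp at this
      omega
    obtain ⟨S, hS, hFS⟩ := a.exists_free_of_isProperFace b ⟨hF.1, hFP⟩
    have hne : S.Nonempty := by
      rw [← Finset.coe_nonempty, ← Set.image_nonempty (f := a.vec b), ← hFS,
        ← convexHull_nonempty_iff (𝕜 := ℝ),
        (a.isCentered_hull b).convexHull_vertices_of_isExposed hF.1]
      exact hF.2.1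
    have hcard := a.finrank_vectorSpan_face b hF.1 hS hFS hne
    rw [hF.2.2, hk] at hcard
    obtain ⟨f, hf, hfS⟩ := CombType.exists_facet hS
    have himage : Finset.univ.image f = S := by
      refine (Finset.eq_of_subset_of_card_le (fun j hj => ?_) ?_).symm
      · simpa using hfS j hj
      · exact Finset.card_image_le.trans (by simp [← hcard])
    have hrange : vertices F = Set.range fun i => a.vec b (f i) := by
      rw [hFS, ← himage, Finset.coe_image, Finset.coe_univ, Set.image_univ, ← Set.range_comp]
      rfl
    rw [IsLatticeBasis, hrange, a.span_facet b hf]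
    refine ⟨?_, hb⟩
    exact ((a.linearIndependent_facet b hf).restrict_scalars' ℤ).linearIndepOn_id

theorem ncard_vertices_hull : (vertices (a.hull b)).ncard = 7 := by
  rw [vertices_hull, ← Set.image_univ, Set.ncard_image_of_injective _ (a.vec_injective b)]
  simp

/-- The standard polyhedron of a name. -/
noncomputable def model : FanoPolyhedron 4 7 :=
  ⟨a.hull (Pi.basisFun ℝ (Fin 4)), a.isFanoPolyhedron_hull rfl, a.ncard_vertices_hull⟩

theorem image_hull (e : (Fin 4 → ℝ) ≃ₗ[ℝ] (Fin 4 → ℝ)) :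
    e '' a.hull b = a.hull (b.map e) := by
  have h : e ∘ a.vec b = a.vec (b.map e) := by
    funext j
    simp [vec]
  rw [hull, hull, ← h, Set.range_comp]
  exact (e : (Fin 4 → ℝ) →ₗ[ℝ] (Fin 4 → ℝ)).image_convexHull _

end Name

theorem act_eq_toLin' {d : ℕ} (A : Matrix (Fin d) (Fin d) ℤ) :
    act A = Matrix.toLin' (A.map (Int.cast : ℤ → ℝ)) := by
  funext x
  simp [act]

/-- The linear automorphism given by an element of `GL(d, ℤ)`. -/
theorem exists_linearEquiv {d : ℕ} (A : GL (Fin d) ℤ) :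
    ∃ e : (Fin d → ℝ) ≃ₗ[ℝ] (Fin d → ℝ), ⇑e = act A.val := by
  refine ⟨LinearEquiv.ofBijective (Matrix.toLin' (A.val.map (Int.cast : ℤ → ℝ)))
    ⟨?_, ?_⟩, (act_eq_toLin' _).symm⟩ <;> rw [← act_eq_toLin']
  · refine Function.LeftInverse.injective (g := act A⁻¹.val) fun x => ?_
    rw [← act_mul, ← Units.val_mul, inv_mul_cancel, Units.val_one, act_one]
  · refine Function.RightInverse.surjective (g := act A⁻¹.val) fun x => ?_
    rw [← act_mul, ← Units.val_mul, mul_inv_cancel, Units.val_one, act_one]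

/-- A lattice basis is the image of the standard basis under an element of `GL(d, ℤ)`. -/
theorem exists_generalLinear {d : ℕ} {b : Basis (Fin d) ℝ (Fin d → ℝ)}
    (hb : Submodule.span ℤ (Set.range b) = stdLattice d) :
    ∃ A : GL (Fin d) ℤ, ∀ i, act A.val (Pi.basisFun ℝ (Fin d) i) = b i := by
  have h₁ : ∀ i m, ∃ n : ℤ, b i m = n := fun i =>
    mem_stdLattice_iff.1 (hb ▸ Submodule.subset_span ⟨i, rfl⟩)
  choose A hA using h₁
  have h₂ : ∀ m, ∃ c : Fin d → ℤ, ∑ i, c i • b i = Pi.basisFun ℝ (Fin d) m := fun m => by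
    rw [← Submodule.mem_span_range_iff_exists_fun, hb]
    exact Submodule.subset_span ⟨m, rfl⟩
  choose B hB using h₂
  -- Both bases generate the same lattice, so the two change-of-basis matrices are integral and
  -- mutually inverse.
  have hmul : (Matrix.of fun m i => A i m) * (Matrix.of fun i m => B m i) = 1 := by
    ext m n
    have := congrFun (hB n) m
    simp only [Finset.sum_apply, zsmul_eq_mul, Pi.basisFun_apply] at this
    rw [Matrix.mul_apply, Matrix.one_apply]
    simp only [Matrix.of_apply]
    have h : ((∑ i, A i m * B n i : ℤ) : ℝ) = ((if m = n then 1 else 0 : ℤ) : ℝ) := by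
      push_cast
      rw [← Pi.single_apply, ← this]
      exact Finset.sum_congr rfl fun i _ => by simp [hA, mul_comm]
    exact_mod_cast h
  refine ⟨⟨_, _, hmul, mul_eq_one_comm.1 hmul⟩, fun i => ?_⟩
  ext m
  simp [act, hA]

/-- Every polyhedron is, in coordinates of a lattice basis, the polytope of some name. -/
theorem exists_eq_hull (P : FanoPolyhedron 4 7) :
    ∃ (a : Name) (b : Basis (Fin 4) ℝ (Fin 4 → ℝ)),
      Submodule.span ℤ (Set.range b) = stdLattice 4 ∧ P.1 = a.hull b := by
  obtain ⟨a, v, hv, hvec⟩ := exists_numbering P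
  obtain ⟨c, hc, -⟩ := P.2.1.exists_special_facet (by norm_num)
  -- All vertices are integral combinations of the base ones, and the vertices of any facet already
  -- generate the lattice.
  have hspan : Submodule.span ℤ (Set.range fun i => v (a.type.base i)) = stdLattice 4 := by
    refine le_antisymm (Submodule.span_le.2 ?_) ?_
    · rintro _ ⟨i, rfl⟩
      exact P.2.1.integral _ (hv ▸ ⟨_, rfl⟩)
    · rw [← hc.span_eq, Submodule.span_le]
      rintro _ ⟨i, rfl⟩
      obtain ⟨j, hj⟩ : c i ∈ Set.range v := hv.symm ▸ hc.mem_vertices i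
      rw [← hj, hvec]
      refine Submodule.sum_mem _ fun i _ => ?_
      rw [Int.cast_smul_eq_zsmul]
      exact Submodule.smul_mem _ _ (Submodule.subset_span ⟨i, rfl⟩)
  have hli := linearIndependent_real_of_span (span_real_eq_top_of_stdLattice_le hspan.ge)
  refine ⟨a, basisOfLinearIndependentOfCardEqFinrank hli (by simp), by simpa using hspan, ?_⟩
  rw [← P.2.1.isCentered.convexHull_vertices, ← hv, Name.hull]
  congr 2
  funext j
  simp [Name.vec, hvec j]

theorem Name.isomorphic_model {a : Name} {P : FanoPolyhedron 4 7}
    {b : Basis (Fin 4) ℝ (Fin 4 → ℝ)} (hb : Submodule.span ℤ (Set.range b) = stdLattice 4)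
    (hP : P.1 = a.hull b) : Isomorphic a.model P := by
  obtain ⟨A, hA⟩ := exists_generalLinear hb
  obtain ⟨e, he⟩ := exists_linearEquiv A
  refine ⟨A, ?_⟩
  rw [hP, ← he]
  refine (a.image_hull e).trans ?_
  congr 1
  refine Basis.eq_of_apply_eq fun i => ?_
  rw [Basis.map_apply, he, hA]

end FanoClassification

namespace FanoClassification

open Module

/-! ### Invariants of systems of relations -/

/-- A numerical invariant of two relations. -/
def pairCode (r s : Finset (Fin 7) × Multiset (Fin 7)) : ℕ :=
  (s.1.card + 2 * s.2.card + r.2.countP (· ∈ s.1) + 3 * r.2.countP (· ∈ s.2)) ^ 2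

/-- A numerical invariant of a system of relations. -/
def Name.code (a : Name) : ℕ :=
  ∑ r ∈ a.relations.toFinset, ∑ s ∈ a.relations.toFinset, pairCode r s

/-- A numerical invariant of a system of primitive collections. -/
def CombType.code (t : CombType) : ℕ := ∑ S ∈ t.collections.toFinset, S.card ^ 2

/-- Renumbering of a relation. -/
def renumber (σ : Equiv.Perm (Fin 7)) (r : Finset (Fin 7) × Multiset (Fin 7)) :
    Finset (Fin 7) × Multiset (Fin 7) := (r.1.map σ.toEmbedding, r.2.map σ)

theorem renumber_injective (σ : Equiv.Perm (Fin 7)) : Function.Injective (renumber σ) := by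
  rintro ⟨S, R⟩ ⟨S', R'⟩ h
  rw [renumber, renumber, Prod.mk.injEq] at h
  exact Prod.ext (Finset.map_injective _ h.1) (Multiset.map_injective σ.injective h.2)

theorem pairCode_renumber (σ : Equiv.Perm (Fin 7)) (r s : Finset (Fin 7) × Multiset (Fin 7)) :
    pairCode (renumber σ r) (renumber σ s) = pairCode r s := by
  simp [pairCode, renumber, Multiset.countP_eq_card_filter, Multiset.filter_map]

/-- The list of all names. -/
def Name.equivSum : Name ≃ Fin 19 ⊕ Fin 3 ⊕ Fin 6 where
  toFun
    | .D i => .inl i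
    | .E i => .inr (.inl i)
    | .G i => .inr (.inr i)
  invFun
    | .inl i => .D i
    | .inr (.inl i) => .E i
    | .inr (.inr i) => .G i
  left_inv a := by cases a <;> rfl
  right_inv x := by rcases x with i | i | i <;> rfl

set_option maxRecDepth 100000 in
theorem Name.code_injective : Function.Injective Name.code := by
  have h : Function.Injective (Name.code ∘ Name.equivSum.symm) := by decide +kernel
  exact (Equiv.injective_comp _ _).1 h

theorem CombType.code_injective : Function.Injective CombType.code := by
  intro s t h
  cases s <;> cases t <;> first | rfl | exact absurd h (by decide +kernel)

theorem CombType.eq_of_perm {s t : CombType} (σ : Equiv.Perm (Fin 7))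
    (h : ∀ S, S ∈ s.collections ↔ S.map σ.toEmbedding ∈ t.collections) : s = t := by
  refine CombType.code_injective ?_
  have himage : t.collections.toFinset =
      s.collections.toFinset.map (Finset.mapEmbedding σ.toEmbedding).toEmbedding := by
    ext S
    simp only [Finset.mem_map, List.mem_toFinset]
    constructor
    · intro hS
      have : (S.map σ.symm.toEmbedding).map σ.toEmbedding = S := by
        rw [Finset.map_map]
        ext
        simp
      exact ⟨S.map σ.symm.toEmbedding, by rwa [h, this], this⟩
    · rintro ⟨T, hT, rfl⟩
      exact (h T).1 hT
  rw [CombType.code, CombType.code, himage, Finset.sum_map]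
  simp

namespace Name

variable {a : Name} {b : Basis (Fin 4) ℝ (Fin 4 → ℝ)}

/-- Evaluate the functional exposing `m` at the common sum: it counts the terms of `m` exactly and
those of `m'` at most, with equality only if every term of `m'` occurs in `m`. -/
theorem card_le_of_sum_eq {m m' : Multiset (Fin 7)} (hm : a.type.Free m.toFinset)
    (h : (m.map (a.vec b)).sum = (m'.map (a.vec b)).sum) :
    m.card ≤ m'.card ∧ (m'.card = m.card → ∀ j ∈ m', j ∈ m) := by
  obtain ⟨l, hl₁, hl₂⟩ := a.exists_functional b hm
  have hle : ∀ j, l (a.vec b j) ≤ 1 := fun j => by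
    by_cases hj : j ∈ m.toFinset
    exacts [(hl₁ j hj).le, (hl₂ j hj).le]
  have hsum := congrArg l h
  rw [map_multiset_sum, map_multiset_sum, Multiset.map_map, Multiset.map_map,
    Multiset.map_congr (f := l ∘ a.vec b) (g := fun _ => (1 : ℝ)) (s := m) rfl
      fun j hj => hl₁ j (by simpa using hj)] at hsum
  have hone : ∀ n : Multiset (Fin 7), (n.map fun _ => (1 : ℝ)).sum = n.card := fun n => by simp
  rw [hone] at hsum
  refine ⟨?_, fun hcard => ?_⟩
  · have : (m'.map (l ∘ a.vec b)).sum ≤ (m'.map fun _ => (1 : ℝ)).sum :=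
      Multiset.sum_map_le_sum_map _ _ fun j _ => hle j
    rw [← hsum, hone] at this
    exact_mod_cast this
  · by_contra! hcon
    obtain ⟨j, hj, hjm⟩ := hcon
    have : (m'.map (l ∘ a.vec b)).sum < (m'.map fun _ => (1 : ℝ)).sum :=
      Multiset.sum_lt_sum (fun j _ => hle j) ⟨j, hj, hl₂ j (by simpa using hjm)⟩
    rw [← hsum, hone, hcard] at this
    exact lt_irrefl _ this

/-- A vector has at most one representation as a sum of vertices of a proper face. -/
theorem eq_of_sum_eq {m m' : Multiset (Fin 7)} (hm : a.type.Free m.toFinset)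
    (hm' : a.type.Free m'.toFinset) (h : (m.map (a.vec b)).sum = (m'.map (a.vec b)).sum) :
    m = m' := by
  obtain ⟨h₁, h₂⟩ := card_le_of_sum_eq hm h
  obtain ⟨h₃, h₄⟩ := card_le_of_sum_eq hm' h.symm
  have hcard := le_antisymm h₁ h₃
  have hmem : m.toFinset = m'.toFinset := by
    ext j
    simpa using ⟨h₄ hcard j, h₂ hcard.symm j⟩
  -- The supports now agree, and linear independence on a face identifies the multiplicities.
  have hli := a.linearIndependent_of_free b hm
  have hsum : ∀ n : Multiset (Fin 7), n.toFinset = m.toFinset →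
      (n.map (a.vec b)).sum = ∑ j : m.toFinset, (n.count (j : Fin 7) : ℝ) • a.vec b j := by
    intro n hn
    rw [Finset.sum_multiset_map_count, hn, ← Finset.sum_coe_sort]
    simp only [Nat.cast_smul_eq_nsmul]
  rw [hsum m rfl, hsum m' hmem.symm, ← sub_eq_zero, ← Finset.sum_sub_distrib] at h
  simp only [← sub_smul] at h
  have hzero := Fintype.linearIndependent_iff.1 hli _ h
  ext j
  by_cases hj : j ∈ m.toFinset
  · have := hzero ⟨j, hj⟩
    rw [sub_eq_zero] at this
    exact_mod_cast this
  · rw [Multiset.count_eq_zero.2 (by simpa using hj),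
      Multiset.count_eq_zero.2 (by rw [hmem] at hj; simpa using hj)]

theorem exists_perm {P : FanoPolyhedron 4 7} (hP : P.1 = a.hull b) {v : Fin 7 ↪ (Fin 4 → ℝ)}
    (hv : IsNumbering P v) :
    ∃ σ : Equiv.Perm (Fin 7), v = σ.toEmbedding.trans (a.vecEmb b) := by
  have h : Set.range v = Set.range (a.vecEmb b) := hv.trans (isNumbering hP).symm
  refine ⟨((Equiv.ofInjective v v.injective).trans (Equiv.setCongr h)).trans
    (Equiv.ofInjective _ (a.vecEmb b).injective).symm, ?_⟩
  ext j : 1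
  exact (congrArg Subtype.val (Equiv.apply_symm_apply
    (Equiv.ofInjective _ (a.vecEmb b).injective) ⟨v j, h ▸ ⟨j, rfl⟩⟩)).symm

theorem type_eq_of_hasType {P : FanoPolyhedron 4 7} (hP : P.1 = a.hull b) {t : CombType}
    (h : HasType P t) : t = a.type := by
  obtain ⟨v, hv, h⟩ := h
  obtain ⟨σ, rfl⟩ := exists_perm hP hv
  refine CombType.eq_of_perm σ fun S => ?_
  rw [← h, hP, ← Finset.map_map, isPrimitiveCollection_iff]

/-- Two numberings of the same vertices differ by a permutation. It carries left sides to left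
sides, and right sides follow because a sum over a face determines its terms. The codes therefore
agree. -/
theorem eq_of_describedBy {P : FanoPolyhedron 4 7} (hP : P.1 = a.hull b) {c : Name}
    (h : DescribedBy P c) : c = a := by
  obtain ⟨v, hv, hcoll, hrel⟩ := h
  obtain ⟨σ, rfl⟩ := exists_perm hP hv
  have hfst : ∀ S, (∃ r ∈ c.relations, r.1 = S) ↔ ∃ r ∈ a.relations, r.1 = S.map σ.toEmbedding :=
    fun S => by
      rw [← hcoll, hP, ← Finset.map_map, isPrimitiveCollection_iff, exists_relation_iff]
  have huniq : ∀ r ∈ a.relations, ∀ s ∈ a.relations, r.1 = s.1 → r = s := fun r hr s hs hrs => by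
    refine Prod.ext hrs (eq_of_sum_eq (b := b) (a.free_right r hr) (a.free_right s hs) ?_)
    rw [← a.sum_vec_eq b hr, ← a.sum_vec_eq b hs, hrs]
  have hmem : ∀ r ∈ c.relations, renumber σ r ∈ a.relations := fun r hr => by
    obtain ⟨s, hs, hsr⟩ := (hfst r.1).1 ⟨r, hr, rfl⟩
    obtain ⟨-, F, hF, -, -, hFR, hsum⟩ := hrel r hr
    rw [hP] at hF
    obtain ⟨T, hT, hFT⟩ := a.exists_free_of_isProperFace b hF
    have hfree : a.type.Free (r.2.map σ).toFinset := hT.mono fun j hj => by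
      obtain ⟨i, hi, rfl⟩ := Multiset.mem_map.1 (Multiset.mem_toFinset.1 hj)
      have : a.vec b (σ i) ∈ vertices F := hFR ▸ Multiset.mem_map.2 ⟨i, hi, rfl⟩
      rw [hFT] at this
      obtain ⟨k, hk, hki⟩ := this
      rwa [← a.vec_injective b hki]
    have hs₂ : s.2 = r.2.map σ := by
      refine eq_of_sum_eq (b := b) (a.free_right s hs) hfree ?_
      rw [← a.sum_vec_eq b hs, hsr, Multiset.map_map, Finset.sum_map]
      rw [Finset.sum_map] at hsum
      exact hsum
    have : s = renumber σ r := Prod.ext hsr hs₂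
    exact this ▸ hs
  have himage : a.relations.toFinset =
      c.relations.toFinset.map ⟨renumber σ, renumber_injective σ⟩ := by
    ext r
    simp only [Finset.mem_map, List.mem_toFinset, Function.Embedding.coeFn_mk]
    constructor
    · intro hr
      have hinv : (r.1.map σ.symm.toEmbedding).map σ.toEmbedding = r.1 := by
        rw [Finset.map_map]
        ext
        simp
      obtain ⟨s, hs, hsr⟩ := (hfst (r.1.map σ.symm.toEmbedding)).2 ⟨r, hr, hinv.symm⟩
      refine ⟨s, hs, huniq _ (hmem s hs) _ hr ?_⟩
      rw [renumber, hsr, hinv]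
    · rintro ⟨s, hs, rfl⟩
      exact hmem s hs
  refine Name.code_injective ?_
  rw [Name.code, Name.code, himage]
  simp only [Finset.sum_map, Function.Embedding.coeFn_mk, pairCode_renumber]

end Name

/-! ### Isomorphism and combinatorial equivalence -/

theorem Isomorphic.exists_eq_hull {P Q : FanoPolyhedron 4 7} (h : Isomorphic P Q) {a : Name}
    {b : Basis (Fin 4) ℝ (Fin 4 → ℝ)} (hP : P.1 = a.hull b) : ∃ c, Q.1 = a.hull c := by
  obtain ⟨A, hA⟩ := h
  obtain ⟨e, he⟩ := exists_linearEquiv A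
  exact ⟨_, by rw [← hA, hP, ← he, a.image_hull]⟩

theorem existsUnique_describedBy (P : FanoPolyhedron 4 7) : ∃! a, DescribedBy P a := by
  obtain ⟨a, b, -, hP⟩ := exists_eq_hull P
  exact ⟨a, Name.describedBy hP, fun c hc => Name.eq_of_describedBy hP hc⟩

theorem DescribedBy.isomorphic_model {P : FanoPolyhedron 4 7} {a : Name} (h : DescribedBy P a) :
    Isomorphic a.model P := by
  obtain ⟨c, b, hb, hP⟩ := exists_eq_hull P
  obtain rfl := Name.eq_of_describedBy hP h
  exact Name.isomorphic_model hb hP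

theorem DescribedBy.isomorphic_iff {P Q : FanoPolyhedron 4 7} {a c : Name} (ha : DescribedBy P a)
    (hc : DescribedBy Q c) : Isomorphic P Q ↔ a = c := by
  constructor
  · intro h
    obtain ⟨a', b, -, hP⟩ := exists_eq_hull P
    obtain rfl := Name.eq_of_describedBy hP ha
    obtain ⟨e, hQ⟩ := h.exists_eq_hull hP
    exact (Name.eq_of_describedBy hQ hc).symm
  · rintro rfl
    have h := isomorphic_equivalence 4 7
    exact h.trans (h.symm ha.isomorphic_model) hc.isomorphic_model

theorem existsUnique_hasType (P : FanoPolyhedron 4 7) : ∃! t, HasType P t := by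
  obtain ⟨a, b, -, hP⟩ := exists_eq_hull P
  exact ⟨a.type, (Name.describedBy hP).hasType, fun t ht => Name.type_eq_of_hasType hP ht⟩

theorem Name.exists_vertexEquiv {P : FanoPolyhedron 4 7} {a : Name}
    {b : Basis (Fin 4) ℝ (Fin 4 → ℝ)} (hP : P.1 = a.hull b) :
    ∃ φ : Fin 7 ≃ vertices P.1, ∀ T : Finset (Fin 7),
      IsSimplexFace P.1 (Subtype.val '' (φ '' (T : Set (Fin 7)))) ↔
        T.Nonempty ∧ a.type.Free T := by
  refine ⟨(Equiv.ofInjective _ (a.vecEmb b).injective).trans (Equiv.setCongr (isNumbering hP)),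
    fun T => ?_⟩
  rw [← a.isSimplexFace_iff b, ← hP, Set.image_image]
  rfl

/-- Nonempty free sets are exactly the simplex faces, and primitive collections are the minimal sets
that are not free, so faces and primitive collections determine each other. -/
theorem combinatoriallyEquivalent_iff {P Q : FanoPolyhedron 4 7} {t : CombType}
    (ht : HasType P t) : CombinatoriallyEquivalent P Q ↔ HasType Q t := by
  obtain ⟨a, b, -, hP⟩ := exists_eq_hull P
  obtain ⟨c, e, -, hQ⟩ := exists_eq_hull Q
  obtain rfl := Name.type_eq_of_hasType hP ht
  obtain ⟨φ, hφ⟩ := Name.exists_vertexEquiv hP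
  obtain ⟨ψ, hψ⟩ := Name.exists_vertexEquiv hQ
  constructor
  · rintro ⟨ρ, hρ⟩
    let σ : Equiv.Perm (Fin 7) := φ.trans (ρ.trans ψ.symm)
    have hfree : ∀ T : Finset (Fin 7), a.type.Free T ↔ c.type.Free (T.map σ.toEmbedding) :=
      fun T => by
      rcases T.eq_empty_or_nonempty with rfl | hT
      -- Simplex faces are nonempty by definition, so the empty set is treated separately.
      · have : ∀ t : CombType, t.Free ∅ := fun t =>
          (t.free_singleton 0).mono (Finset.empty_subset _)
        simp [this]
      · have h₁ := hφ T
        have h₂ := hψ (T.map σ.toEmbedding)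
        have himage : ψ '' ((T.map σ.toEmbedding : Finset (Fin 7)) : Set (Fin 7)) =
            ρ '' (φ '' (T : Set (Fin 7))) := by
          rw [Finset.coe_map, Set.image_image, Set.image_image]
          simp [σ]
        rw [himage, ← hρ, h₁] at h₂
        simpa [hT] using h₂
    have heq : a.type = c.type := by
      refine CombType.eq_of_perm σ fun S => ?_
      rw [CombType.mem_collections_iff, CombType.mem_collections_iff, ← hfree]
      refine and_congr_right fun _ => ⟨fun h T hT => ?_, fun h T hT => ?_⟩
      · obtain ⟨U, -, rfl⟩ := Finset.subset_map_iff.1 hT.subset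
        exact (hfree U).1 (h U (Finset.map_ssubset_map.1 hT))
      · exact (hfree T).2 (h _ (Finset.map_ssubset_map.2 hT))
    rw [heq]
    exact (Name.describedBy hQ).hasType
  · intro h
    have heq := Name.type_eq_of_hasType hQ h
    refine ⟨φ.symm.trans ψ, fun S => ?_⟩
    obtain ⟨T, hT⟩ := (Set.toFinite (φ ⁻¹' S)).exists_finset_coe
    have hS : S = φ '' (T : Set (Fin 7)) := by
      rw [hT, Set.image_preimage_eq _ φ.surjective]
    have hS' : (φ.symm.trans ψ) '' S = ψ '' (T : Set (Fin 7)) := by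
      rw [hS, Set.image_image]
      simp
    rw [hS', hS, hφ, hψ, heq]

/-! ### Counting -/

theorem Name.bijective_isoClass : Function.Bijective fun a : Name => a.model.isoClass := by
  refine ⟨fun a c h => ?_, fun q => ?_⟩
  · have h : Isomorphic a.model c.model := Quotient.exact h
    exact (DescribedBy.isomorphic_iff (Name.describedBy rfl) (Name.describedBy rfl)).1 h
  · obtain ⟨P, rfl⟩ := Quotient.exists_rep q
    obtain ⟨a, b, hb, hP⟩ := FanoClassification.exists_eq_hull P
    exact ⟨a, Quotient.sound (Name.isomorphic_model hb hP)⟩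

theorem classesOfType_eq (t : CombType) :
    classesOfType t = (fun a : Name => a.model.isoClass) '' {a | a.type = t} := by
  ext q
  constructor
  · rintro ⟨P, rfl, ht⟩
    obtain ⟨a, b, hb, hP⟩ := FanoClassification.exists_eq_hull P
    exact ⟨a, (Name.type_eq_of_hasType hP ht).symm, Quotient.sound (Name.isomorphic_model hb hP)⟩
  · rintro ⟨a, rfl, rfl⟩
    exact ⟨a.model, rfl, (Name.describedBy rfl).hasType⟩

theorem card_isoClass : Nat.card (IsoClass 4 7) = 28 := by
  rw [← Nat.card_congr (Equiv.ofBijective _ Name.bijective_isoClass),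
    Nat.card_congr Name.equivSum]
  simp

theorem ncard_classesOfType {n : ℕ} (f : Fin n → Name) (hf : f.Injective) (t : CombType)
    (h : {a : Name | a.type = t} = Set.range f) : (classesOfType t).ncard = n := by
  rw [classesOfType_eq, Set.ncard_image_of_injective _ Name.bijective_isoClass.1, h,
    ← Set.image_univ, Set.ncard_image_of_injective _ hf]
  simp

theorem ncard_classesOfType_D : (classesOfType .D).ncard = 19 :=
  ncard_classesOfType Name.D (fun _ _ h => by simpa using h) _ <| by
    ext a
    cases a <;> simp [Name.type]

theorem ncard_classesOfType_E : (classesOfType .E).ncard = 3 :=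
  ncard_classesOfType Name.E (fun _ _ h => by simpa using h) _ <| by
    ext a
    cases a <;> simp [Name.type]

theorem ncard_classesOfType_G : (classesOfType .G).ncard = 6 :=
  ncard_classesOfType Name.G (fun _ _ h => by simpa using h) _ <| by
    ext a
    cases a <;> simp [Name.type]

end FanoClassification

theorem mainTheorem4 :
    -- there are exactly 28 four-dimensional Fano polyhedra with 7 vertices
    Nat.card (FanoClassification.IsoClass 4 7) = 28 ∧
    -- they have exactly three combinatorial types `D`, `E`, `G`
    (∀ P : FanoClassification.FanoPolyhedron 4 7,
      ∃! t : FanoClassification.CombType, FanoClassification.HasType P t) ∧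
    (∀ (P Q : FanoClassification.FanoPolyhedron 4 7) (t : FanoClassification.CombType),
      FanoClassification.HasType P t →
        (FanoClassification.CombinatoriallyEquivalent P Q ↔ FanoClassification.HasType Q t)) ∧
    -- the number of polyhedra of each type
    (FanoClassification.classesOfType .D).ncard = 19 ∧
    (FanoClassification.classesOfType .E).ncard = 3 ∧
    (FanoClassification.classesOfType .G).ncard = 6 ∧
    -- each listed system of primitive relations defines exactly one polyhedron, of the type
    -- indicated by its name, and every polyhedron is listed exactly once
    (∀ a : FanoClassification.Name, ∃ P : FanoClassification.FanoPolyhedron 4 7,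
      FanoClassification.DescribedBy P a) ∧
    (∀ (P : FanoClassification.FanoPolyhedron 4 7) (a : FanoClassification.Name),
      FanoClassification.DescribedBy P a → FanoClassification.HasType P a.type) ∧
    (∀ P : FanoClassification.FanoPolyhedron 4 7,
      ∃! a : FanoClassification.Name, FanoClassification.DescribedBy P a) ∧
    (∀ (P Q : FanoClassification.FanoPolyhedron 4 7) (a b : FanoClassification.Name),
      FanoClassification.DescribedBy P a → FanoClassification.DescribedBy Q b →
        (FanoClassification.Isomorphic P Q ↔ a = b)) := by
  exact ⟨FanoClassification.card_isoClass, FanoClassification.existsUnique_hasType,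
    fun _ _ _ h => FanoClassification.combinatoriallyEquivalent_iff h,
    FanoClassification.ncard_classesOfType_D, FanoClassification.ncard_classesOfType_E,
    FanoClassification.ncard_classesOfType_G,
    fun a => ⟨a.model, FanoClassification.Name.describedBy rfl⟩,
    fun _ _ h => h.hasType, FanoClassification.existsUnique_describedBy,
    fun _ _ _ _ h h' => h.isomorphic_iff h'⟩
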